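/- Fix a real number $a>0$ and let $v,d\in\mathbb{C}$ with $v\neq 0$ and $d\neq 0$. In $\mathbb{C}P^4$ with homogeneous coordinates $[t,y_1,y_2,r_1,r_2]$ let $HC_F(v,d)$ be the equal-velocity Ho--Chen FDOA variety, with sensors at $(\pm a,0)$ and both velocities equal to $(0,v)$; that is, the common zero set of $$Q_1=(at-y_1)^2+y_2^2-r_1^2,\qquad Q_2=(at+y_1)^2+y_2^2-r_2^2,\qquad \tilde Q=L_2r_1-L_1r_2-d\,r_1r_2,$$ where $L_1=L_2=-v\,y_2$. Equivalently, in the coordinates $[z_0,z_1,z_2,z_3,x]$ given by $at=\frac{z_2-z_3}{8}$, $y_1=-\frac{z_2+z_3}{8}$, $y_2=-\frac{x}{4}$, $r_1=\frac{z_0}{4}$, $r_2=\frac{z_1}{4}$, it is defined by $$z_2^2-z_0^2=z_3^2-z_1^2,\qquad x^2+z_2^2-z_0^2=0,\qquad v(z_0-z_1)x-d\,z_0z_1=0.$$ Let $V(v,d)\subset\mathbb{C}P^2$ be the plane quartic $$2v\,u_0u_2(u_1^2+u_2^2)-2v\,u_1u_2(u_0^2+u_2^2)-d(u_1^2+u_2^2)(u_0^2+u_2^2)=0.$$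 A point of $HC_F(v,d)$ is called singular if the $3\times 5$ matrix of partial derivatives of the three defining equations has rank less than $3$ there. In the $[z_0,z_1,z_2,z_3,x]$-coordinates put $$p_1=[-1,0,1,0,0],\quad p_2=[1,0,1,0,0],\quad p_3=[0,-1,0,1,0],\quad p_4=[0,1,0,1,0],$$ $$q=[1,-1,0,0,1],\qquad \tilde q=[1,-1,0,0,-1].$$ Then $HC_F(v,d)$ and $V(v,d)$ are irreducible curves, and $HC_F(v,d)$ is birational to $V(v,d)$. If $d^2\neq 4v^2$, then $HC_F(v,d)$ has exactly four singular points, $p_1,p_2,p_3,p_4$. If $d=2v$, it has exactly five singular points, $p_1,p_2,p_3,p_4,\tilde q$; if $d=-2v$, it has exactly five singular points, $p_1,p_2,p_3,p_4,q$. -/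

import Mathlib

open MvPolynomial

noncomputable section

namespace HoChen

/-- Complex projective space `ℂPⁿ`, with homogeneous coordinates indexed by `Fin (n + 1)`. -/
abbrev CP (n : ℕ) : Type := Projectivization ℂ (Fin (n + 1) → ℂ)

/-- The point of `ℂPⁿ` with homogeneous coordinates `x`. -/
def pt {n : ℕ} (x : Fin (n + 1) → ℂ) (hx : x ≠ 0) : CP n := Projectivization.mk ℂ x hx

/-- The common zeros in `ℂPⁿ` of a family of polynomials. It is only used for homogeneous
polynomials, for which it does not matter at which representative we evaluate. -/
def zeroLocus {n : ℕ} {ι : Type} (F : ι → MvPolynomial (Fin (n + 1)) ℂ) : Set (CP n) :=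
  {p | ∀ i, eval p.rep (F i) = 0}

/-- Projective subvarieties of `ℂPⁿ` (not necessarily irreducible): the zero sets of arbitrary
families of homogeneous polynomials. -/
def IsSubvariety {n : ℕ} (Z : Set (CP n)) : Prop :=
  ∃ S : Set (MvPolynomial (Fin (n + 1)) ℂ),
    (∀ f ∈ S, ∃ k, f.IsHomogeneous k) ∧ Z = {p | ∀ f ∈ S, eval p.rep f = 0}

/-- The Zariski topology on `ℂPⁿ`: the closed sets are the projective subvarieties. -/
instance zariskiTopology (n : ℕ) : TopologicalSpace (CP n) :=
  TopologicalSpace.ofClosed {Z | IsSubvariety Z}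
    (by
      refine ⟨{1}, ?_, ?_⟩
      · rintro f rfl
        exact ⟨0, isHomogeneous_one _ _⟩
      · ext p
        simp)
    (by
      intro A hA
      have hA' : ∀ Z ∈ A, IsSubvariety Z := fun Z hZ => hA hZ
      choose! S hS using hA'
      refine ⟨⋃ Z ∈ A, S Z, ?_, ?_⟩
      · intro f hf
        simp only [Set.mem_iUnion] at hf
        obtain ⟨Z, hZ, hf⟩ := hf
        exact (hS Z hZ).1 f hf
      · ext p
        simp only [Set.mem_sInter, Set.mem_iUnion, Set.mem_ofPred_eq]
        constructor
        · rintro h f ⟨Z, hZ, hf⟩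
          have h1 := h Z hZ
          rw [(hS Z hZ).2] at h1
          exact h1 f hf
        · intro h Z hZ
          rw [(hS Z hZ).2]
          exact fun f hf => h f ⟨Z, hZ, hf⟩)
    (by
      rintro A ⟨S, hS, rfl⟩ B ⟨T, hT, rfl⟩
      refine ⟨{h | ∃ f ∈ S, ∃ g ∈ T, h = f * g}, ?_, ?_⟩
      · rintro h ⟨f, hf, g, hg, rfl⟩
        obtain ⟨k, hk⟩ := hS f hf
        obtain ⟨l, hl⟩ := hT g hg
        exact ⟨k + l, hk.mul hl⟩
      · ext p
        simp only [Set.mem_union, Set.mem_ofPred_eq]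
        constructor
        · rintro (h | h) _ ⟨f, hf, g, hg, rfl⟩
          · simp [h f hf]
          · simp [h g hg]
        · intro h
          by_contra! hc
          obtain ⟨⟨f, hf, hf0⟩, ⟨g, hg, hg0⟩⟩ := hc
          have := h _ ⟨f, hf, g, hg, rfl⟩
          rw [map_mul] at this
          exact (mul_ne_zero hf0 hg0) this)

/-- An irreducible projective curve: a Zariski closed, irreducible subset of dimension one. -/
def IsIrreducibleCurve {n : ℕ} (Z : Set (CP n)) : Prop :=
  IsClosed Z ∧ IsIrreducible Z ∧ topologicalKrullDim Z = 1

/-- `n + 1` homogeneous polynomials of the same degree in `m + 1` variables, defining a rational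
map from (subvarieties of) `ℂPᵐ` to `ℂPⁿ`. -/
structure RatMap (m n : ℕ) where
  degree : ℕ
  poly : Fin (n + 1) → MvPolynomial (Fin (m + 1)) ℂ
  homogeneous : ∀ i, (poly i).IsHomogeneous degree

/-- `φ.Maps p q` says that the rational map `φ` is defined at `p` (its components do not all
vanish there) and that its value is `q`. -/
def RatMap.Maps {m n : ℕ} (φ : RatMap m n) (p : CP m) (q : CP n) : Prop :=
  ∃ h : (fun i => eval p.rep (φ.poly i)) ≠ 0, pt (fun i => eval p.rep (φ.poly i)) h = q

/-- Two subvarieties `V`, `W` are birational if there are rational maps `φ : V ⇢ W` and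
`ψ : W ⇢ V` that restrict to mutually inverse bijections between a dense open subset `V ∩ U`
of `V` and a dense open subset `W ∩ U'` of `W`. -/
def Birational {m n : ℕ} (V : Set (CP m)) (W : Set (CP n)) : Prop :=
  ∃ (φ : RatMap m n) (ψ : RatMap n m) (U : Set (CP m)) (U' : Set (CP n)),
    IsOpen U ∧ IsOpen U' ∧ V ⊆ closure (V ∩ U) ∧ W ⊆ closure (W ∩ U') ∧
    (∀ p ∈ V ∩ U, ∃ q ∈ W ∩ U', φ.Maps p q ∧ ψ.Maps q p) ∧
    (∀ q ∈ W ∩ U', ∃ p ∈ V ∩ U, ψ.Maps q p ∧ φ.Maps p q)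

/-- The matrix of partial derivatives of a family of polynomials at (a representative of) `p`. -/
def jacobian {n : ℕ} {ι : Type} (F : ι → MvPolynomial (Fin (n + 1)) ℂ) (p : CP n) :
    Matrix ι (Fin (n + 1)) ℂ :=
  Matrix.of fun i j => eval p.rep (pderiv j (F i))

/-- The singular points of the subvariety with defining equations `F`: the points of the
subvariety at which the matrix of partial derivatives drops in rank. It is used for complete
intersections, where the number of equations is the codimension. -/
def singularPoints {n : ℕ} {ι : Type} [Fintype ι]
    (F : ι → MvPolynomial (Fin (n + 1)) ℂ) : Set (CP n) :=
  {p ∈ zeroLocus F | (jacobian F p).rank < Fintype.card ι}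

/-! ### The curves on `ℂP⁴`

The homogeneous coordinates `[t, y₁, y₂, r₁, r₂]` on `ℂP⁴` are the variables `X 0, …, X 4`.
The sensors are at `(a, 0)` and `(-a, 0)`. -/

/-- `Q₁ = (a t - y₁)² + y₂² - r₁²`. -/
def Q₁ (a : ℝ) : MvPolynomial (Fin 5) ℂ :=
  (C (a : ℂ) * X 0 - X 1) ^ 2 + X 2 ^ 2 - X 3 ^ 2

/-- `Q₂ = (a t + y₁)² + y₂² - r₂²`. -/
def Q₂ (a : ℝ) : MvPolynomial (Fin 5) ℂ :=
  (C (a : ℂ) * X 0 + X 1) ^ 2 + X 2 ^ 2 - X 4 ^ 2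

/-- `L₁ = v₁ · (s₁ t - y)` with `s₁ = (a, 0)`. -/
def L₁ (a : ℝ) (v₁ : Fin 2 → ℂ) : MvPolynomial (Fin 5) ℂ :=
  C (v₁ 0) * (C (a : ℂ) * X 0 - X 1) - C (v₁ 1) * X 2

/-- `L₂ = v₂ · (s₂ t - y)` with `s₂ = (-a, 0)`. -/
def L₂ (a : ℝ) (v₂ : Fin 2 → ℂ) : MvPolynomial (Fin 5) ℂ :=
  C (v₂ 0) * (-(C (a : ℂ) * X 0) - X 1) - C (v₂ 1) * X 2

/-- The FDOA polynomial `L₂ r₁ - L₁ r₂ - d r₁ r₂`. -/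
def fdoaPoly (a : ℝ) (v₁ v₂ : Fin 2 → ℂ) (d : ℂ) : MvPolynomial (Fin 5) ℂ :=
  L₂ a v₂ * X 3 - L₁ a v₁ * X 4 - C d * X 3 * X 4

/-- The three defining equations of the Ho-Chen FDOA variety. -/
def hcEquations (a : ℝ) (v₁ v₂ : Fin 2 → ℂ) (d : ℂ) : Fin 3 → MvPolynomial (Fin 5) ℂ :=
  ![Q₁ a, Q₂ a, fdoaPoly a v₁ v₂ d]

/-- The Ho-Chen FDOA variety `HC_F((v₁, v₂), d)` in `ℂP⁴`. -/
def HCF (a : ℝ) (v₁ v₂ : Fin 2 → ℂ) (d : ℂ) : Set (CP 4) :=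
  zeroLocus (hcEquations a v₁ v₂ d)

/-- The plane quartic polynomial `P((v₁, v₂), d)` in the variables `u₀, u₁, u₂`. -/
def quarticPoly (v₁ v₂ : Fin 2 → ℂ) (d : ℂ) : MvPolynomial (Fin 3) ℂ :=
  C (2 * v₂ 1) * X 0 * X 2 * (X 1 ^ 2 + X 2 ^ 2)
    - C (2 * v₁ 1) * X 1 * X 2 * (X 0 ^ 2 + X 2 ^ 2)
    + C (v₂ 0) * (X 2 ^ 2 - X 0 ^ 2) * (X 2 ^ 2 + X 1 ^ 2)
    - C (v₁ 0) * (X 2 ^ 2 - X 1 ^ 2) * (X 0 ^ 2 + X 2 ^ 2)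
    - C d * (X 1 ^ 2 + X 2 ^ 2) * (X 0 ^ 2 + X 2 ^ 2)

/-- The plane quartic curve `V((v₁, v₂), d)` in `ℂP²`. -/
def planeQuartic (v₁ v₂ : Fin 2 → ℂ) (d : ℂ) : Set (CP 2) :=
  zeroLocus (fun _ : Fin 1 => quarticPoly v₁ v₂ d)

/-! ### The special points

The coordinates below are again `[t, y₁, y₂, r₁, r₂]`; the comments give the same points in the
coordinates `[z₀, z₁, z₂, z₃, x]`, which are related to them by
`a t = (z₂ - z₃)/8`, `y₁ = -(z₂ + z₃)/8`, `y₂ = -x/4`, `r₁ = z₀/4`, `r₂ = z₁/4`. -/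

/-- `[-1, 0, 1, 0, 0]` in the `[z, x]`-coordinates. -/
def p₁ (a : ℝ) : CP 4 :=
  pt ![1, -(a : ℂ), 0, -2 * (a : ℂ), 0] (fun h => by simpa using congrFun h 0)

/-- `[1, 0, 1, 0, 0]` in the `[z, x]`-coordinates. -/
def p₂ (a : ℝ) : CP 4 :=
  pt ![1, -(a : ℂ), 0, 2 * (a : ℂ), 0] (fun h => by simpa using congrFun h 0)

/-- `[0, -1, 0, 1, 0]` in the `[z, x]`-coordinates. -/
def p₃ (a : ℝ) : CP 4 :=
  pt ![1, (a : ℂ), 0, 0, 2 * (a : ℂ)] (fun h => by simpa using congrFun h 0)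

/-- `[0, 1, 0, 1, 0]` in the `[z, x]`-coordinates. -/
def p₄ (a : ℝ) : CP 4 :=
  pt ![1, (a : ℂ), 0, 0, -2 * (a : ℂ)] (fun h => by simpa using congrFun h 0)

/-- `[1, -1, 0, 0, 1]` in the `[z, x]`-coordinates. -/
def q : CP 4 :=
  pt ![0, 0, -1, 1, -1] (fun h => by simpa using congrFun h 3)

/-- `[1, -1, 0, 0, -1]` in the `[z, x]`-coordinates. -/
def qTilde : CP 4 :=
  pt ![0, 0, 1, 1, -1] (fun h => by simpa using congrFun h 3)

end HoChen

end

/-! Put `c = d / v`, `N = 1 + u²`, `M = c u² + 2 u + c`. Both curves are parametrized by the same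
double cover `w² = N² - M²`. On the quartic take `u = u₁/u₂`: the equation becomes `M s² - 2 N s + M
= 0` for `s = u₀/u₂`, whose reduced discriminant is `N² - M²`. On the Ho-Chen curve let `u` be the
rational parameter of the conic `Q₁ = 0`. The FDOA equation then gives `r₂` rationally, and `Q₂ = 0`
becomes the equation of the double cover.

`N² - M²` has a simple root (`exists_simple_root_coverPoly`), hence a function `A(u) + B(u) w` with
infinitely many zeros on the cover is zero: its norm `A² - (N² - M²) B²` is the zero polynomial, and
parity of multiplicity at the simple root forces `A = B = 0`. Pulled back along the charts, this
says that a form with infinitely many zeros on either curve vanishes on it (`VanishesOfInfinite`,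
via `vanishesOfInfinite_of_charts`). So proper closed subsets are finite, which yields
irreducibility, dimension one, and density of every infinite subset.

The birational maps send a point to the rational parameters of the two conics and back. The singular
points come from a case analysis of a linear relation among the three gradients
(`mem_singularPoints_iff`). -/

noncomputable section

namespace HoChen

/-! ### Spaces whose proper closed subsets are finite. -/

section Topology

variable {X : Type*} [TopologicalSpace X]

theorem finite_isPreirreducible_subsingleton [T1Space X] {S : Set X} (hS : S.Finite)
    (h : IsPreirreducible S) : S.Subsingleton :=
  hS.isDiscrete.subsingleton_of_isPreirreducible h

/-- An infinite `T₁` space whose proper closed subsets are finite is irreducible. -/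
theorem isIrreducible_univ_of_finite_closed [Infinite X]
    (h : ∀ C : Set X, IsClosed C → C.Infinite → C = Set.univ) : IsIrreducible (Set.univ : Set X) := by
  refine ⟨Set.univ_nonempty, isPreirreducible_iff_isClosed_union_isClosed.2 ?_⟩
  intro A B hA hB hAB
  have hinf : (A ∪ B).Infinite := Set.infinite_univ.mono hAB
  rcases Set.infinite_union.1 hinf with h1 | h1
  · exact Or.inl (h A hA h1).symm.subset
  · exact Or.inr (h B hB h1).symm.subset

/-- An irreducible closed set is the whole space if infinite and a single point if finite, so chains
have length at most one; a point inside the whole space gives length one. -/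
theorem topologicalKrullDim_eq_one_of_finite_closed [T1Space X] [Infinite X]
    (h : ∀ C : Set X, IsClosed C → C.Infinite → C = Set.univ) : topologicalKrullDim X = 1 := by
  unfold topologicalKrullDim
  apply le_antisymm
  · rw [Order.krullDim_le_one_iff]
    intro Z
    by_cases hZ : (Z : Set X).Infinite
    · right
      intro W _
      have : (Z : Set X) = Set.univ := h _ Z.isClosed hZ
      exact fun x _ => by rw [← SetLike.mem_coe, this]; trivial
    · left
      intro W hWZ x hx
      obtain ⟨y, hy⟩ := W.isIrreducible.nonempty
      have := finite_isPreirreducible_subsingleton (Set.not_infinite.1 hZ)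
        Z.isIrreducible.isPreirreducible hx (hWZ hy)
      rw [this]
      exact hy
  · rw [WithBot.one_le_iff_pos, Order.krullDim_pos_iff]
    obtain ⟨x⟩ := (inferInstance : Nonempty X)
    refine ⟨⟨{x}, isIrreducible_singleton, isClosed_singleton⟩,
      ⟨Set.univ, isIrreducible_univ_of_finite_closed h, isClosed_univ⟩, ?_⟩
    refine lt_of_le_of_ne (fun _ _ => trivial) fun e => ?_
    have e' : ({x} : Set X) = Set.univ := congrArg (fun Z => Z.carrier) e
    exact Set.infinite_univ (e' ▸ Set.finite_singleton x)

end Topology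

/-! ### Zariski topology on projective space and a criterion for irreducible curves. -/

section Projective

variable {n : ℕ}

theorem eval_smul_of_isHomogeneous {σ : Type*} {f : MvPolynomial σ ℂ} {k : ℕ}
    (hf : f.IsHomogeneous k) (r : ℂ) (x : σ → ℂ) : eval (r • x) f = r ^ k * eval x f := by
  rw [eval_eq, eval_eq, Finset.mul_sum]
  refine Finset.sum_congr rfl fun m hm => ?_
  have hk : m.degree = k := by
    rw [Finsupp.degree_eq_weight_one]; exact hf (mem_support_iff.1 hm)
  simp only [Pi.smul_apply, smul_eq_mul, mul_pow, Finset.prod_mul_distrib, Finset.prod_pow_eq_pow_sum]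
  rw [← hk, Finsupp.degree_apply]
  ring

theorem eval_smul_eq_zero_iff {σ : Type*} {f : MvPolynomial σ ℂ} {k : ℕ}
    (hf : f.IsHomogeneous k) {r : ℂ} (hr : r ≠ 0) (x : σ → ℂ) :
    eval (r • x) f = 0 ↔ eval x f = 0 := by
  rw [eval_smul_of_isHomogeneous hf, mul_eq_zero, or_iff_right (pow_ne_zero _ hr)]

theorem rep_pt (x : Fin (n + 1) → ℂ) (hx : x ≠ 0) : ∃ r : ℂ, r ≠ 0 ∧ (pt x hx).rep = r • x := by
  obtain ⟨r, hr⟩ := Projectivization.exists_smul_eq_mk_rep ℂ x hx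
  exact ⟨r, r.ne_zero, hr.symm⟩

theorem eq_pt_iff (p : CP n) (x : Fin (n + 1) → ℂ) (hx : x ≠ 0) :
    p = pt x hx ↔ ∃ r : ℂ, r ≠ 0 ∧ p.rep = r • x := by
  constructor
  · rintro rfl
    exact rep_pt x hx
  · rintro ⟨r, -, h⟩
    rw [← p.mk_rep, pt, Projectivization.mk_eq_mk_iff']
    exact ⟨r, h.symm⟩

theorem pt_ne_pt_of_minor {x y : Fin (n + 1) → ℂ} {hx : x ≠ 0} {hy : y ≠ 0} (i j : Fin (n + 1))
    (h : x i * y j ≠ x j * y i) : pt x hx ≠ pt y hy := by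
  intro e
  rw [pt, pt, Projectivization.mk_eq_mk_iff'] at e
  obtain ⟨r, hr⟩ := e
  apply h
  rw [← hr]
  simp only [Pi.smul_apply, smul_eq_mul]
  ring

theorem isClosed_iff_isSubvariety (Z : Set (CP n)) : IsClosed Z ↔ IsSubvariety Z := by
  rw [← isOpen_compl_iff]
  change IsSubvariety Zᶜᶜ ↔ _
  rw [compl_compl]

theorem isClosed_zeroLocus {ι : Type} {F : ι → MvPolynomial (Fin (n + 1)) ℂ}
    (hF : ∀ i, ∃ k, (F i).IsHomogeneous k) : IsClosed (zeroLocus F) := by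
  rw [isClosed_iff_isSubvariety]
  refine ⟨Set.range F, ?_, ?_⟩
  · rintro _ ⟨i, rfl⟩
    exact hF i
  · ext p
    simp [zeroLocus]

/-- A point is cut out by the 2×2 minors of its coordinates against the variables. -/
instance : T1Space (CP n) := by
  refine ⟨fun p => ?_⟩
  rw [isClosed_iff_isSubvariety]
  refine ⟨Set.range fun ij : Fin (n + 1) × Fin (n + 1) =>
    C (p.rep ij.1) * X ij.2 - C (p.rep ij.2) * X ij.1, ?_, ?_⟩
  · rintro _ ⟨ij, rfl⟩
    exact ⟨1, (isHomogeneous_C_mul_X _ _).sub (isHomogeneous_C_mul_X _ _)⟩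
  · ext x
    simp only [Set.mem_singleton_iff, Set.forall_mem_range,
      Prod.forall, Set.mem_ofPred_eq, map_sub, map_mul, eval_C, eval_X]
    constructor
    · rintro rfl i j
      ring
    · intro h
      obtain ⟨i, hi⟩ := Function.ne_iff.1 p.rep_nonzero
      rw [← x.mk_rep, ← p.mk_rep, Projectivization.mk_eq_mk_iff']
      refine ⟨x.rep i / p.rep i, ?_⟩
      ext j
      have := h i j
      simp only [Pi.zero_apply] at hi
      simp only [Pi.smul_apply, smul_eq_mul]
      field_simp
      linear_combination -this

/-- Every homogeneous polynomial with infinitely many zeros on `Z` vanishes on `Z`. -/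
def VanishesOfInfinite (Z : Set (CP n)) : Prop :=
  ∀ (f : MvPolynomial (Fin (n + 1)) ℂ) (k : ℕ), f.IsHomogeneous k →
    {p ∈ Z | eval p.rep f = 0}.Infinite → ∀ p ∈ Z, eval p.rep f = 0

theorem VanishesOfInfinite.subset_of_isClosed {Z : Set (CP n)} (hZ : VanishesOfInfinite Z)
    {W : Set (CP n)} (hW : IsClosed W) (h : (Z ∩ W).Infinite) : Z ⊆ W := by
  obtain ⟨S, hS, rfl⟩ := (isClosed_iff_isSubvariety W).1 hW
  intro p hp f hf
  obtain ⟨k, hk⟩ := hS f hf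
  exact hZ f k hk (h.mono fun x hx => ⟨hx.1, hx.2 f hf⟩) p hp

theorem VanishesOfInfinite.isIrreducibleCurve {Z : Set (CP n)} (hZ : VanishesOfInfinite Z)
    (hc : IsClosed Z) (hi : Z.Infinite) : IsIrreducibleCurve Z := by
  have : Infinite Z := hi.to_subtype
  have key : ∀ C : Set Z, IsClosed C → C.Infinite → C = Set.univ := by
    intro C hC hinf
    obtain ⟨W, hW, rfl⟩ := isClosed_induced_iff.1 hC
    have := hZ.subset_of_isClosed hW (by
      rw [← Subtype.image_preimage_coe]
      exact hinf.image Subtype.val_injective.injOn)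
    ext x
    simpa using this x.2
  refine ⟨hc, ?_, topologicalKrullDim_eq_one_of_finite_closed key⟩
  have := (isIrreducible_univ_of_finite_closed key).image Subtype.val continuous_subtype_val.continuousOn
  simpa using this

/-- Supplies the density required of the open sets in `Birational`. -/
theorem VanishesOfInfinite.subset_closure {Z U : Set (CP n)} (hZ : VanishesOfInfinite Z)
    (h : (Z ∩ U).Infinite) : Z ⊆ closure (Z ∩ U) :=
  hZ.subset_of_isClosed isClosed_closure (h.mono fun _ hx => ⟨hx.1, _root_.subset_closure hx⟩)

end Projective

/-! ### Functions on the double cover `w² = h(u)`. -/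

section DoubleCover

open Polynomial in
/-- The affine curve `w² = h(u)`. -/
def doubleCover (h : ℂ[X]) : Set (ℂ × ℂ) := {e | e.2 ^ 2 = h.eval e.1}

open Polynomial in
/-- A function on `w² = h(u)` of the form `A(u) + B(u) w`. -/
def IsRegularOn (h : ℂ[X]) (g : ℂ × ℂ → ℂ) : Prop :=
  ∃ A B : ℂ[X], ∀ e ∈ doubleCover h, g e = A.eval e.1 + B.eval e.1 * e.2

variable {h : Polynomial ℂ} {g g' : ℂ × ℂ → ℂ}

theorem IsRegularOn.add (hg : IsRegularOn h g) (hg' : IsRegularOn h g') :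
    IsRegularOn h (fun e => g e + g' e) := by
  obtain ⟨A, B, hAB⟩ := hg
  obtain ⟨A', B', hAB'⟩ := hg'
  refine ⟨A + A', B + B', fun e he => ?_⟩
  simp only [hAB e he, hAB' e he, Polynomial.eval_add]
  ring

theorem IsRegularOn.mul (hg : IsRegularOn h g) (hg' : IsRegularOn h g') :
    IsRegularOn h (fun e => g e * g' e) := by
  obtain ⟨A, B, hAB⟩ := hg
  obtain ⟨A', B', hAB'⟩ := hg'
  refine ⟨A * A' + B * B' * h, A * B' + A' * B, fun e he => ?_⟩
  have he' : e.2 ^ 2 = h.eval e.1 := he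
  simp only [hAB e he, hAB' e he, Polynomial.eval_add, Polynomial.eval_mul, ← he']
  ring

theorem isRegularOn_poly (A : Polynomial ℂ) : IsRegularOn h (fun e => A.eval e.1) :=
  ⟨A, 0, fun e _ => by simp⟩

theorem isRegularOn_snd : IsRegularOn h (fun e => e.2) :=
  ⟨0, 1, fun e _ => by simp⟩

theorem IsRegularOn.eval {σ : Type*} {Φ : ℂ × ℂ → σ → ℂ}
    (hΦ : ∀ i, IsRegularOn h (fun e => Φ e i)) (f : MvPolynomial σ ℂ) :
    IsRegularOn h (fun e => MvPolynomial.eval (Φ e) f) := by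
  induction f using MvPolynomial.induction_on with
  | C c => simpa using isRegularOn_poly (h := h) (Polynomial.C c)
  | add p q hp hq => simpa using hp.add hq
  | mul_X p i hp => simpa using hp.mul (hΦ i)

theorem finite_doubleCover_of_finite_fst {S : Set (ℂ × ℂ)} (hS : S ⊆ doubleCover h)
    (hfin : (Prod.fst '' S).Finite) : S.Finite := by
  refine Set.Finite.of_finite_fibers Prod.fst hfin fun u _ => ?_
  refine ((Polynomial.X ^ 2 - Polynomial.C (h.eval u) : Polynomial ℂ).roots.toFinset.finite_toSet.image
    (fun w => (u, w))).subset ?_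
  rintro ⟨u', w⟩ ⟨hm, rfl⟩
  have he : w ^ 2 = h.eval u' := hS hm
  refine ⟨w, ?_, rfl⟩
  have := Polynomial.X_pow_sub_C_ne_zero (n := 2) two_pos (h.eval u')
  simp [this, he]

open Polynomial in
-- If `B ≠ 0`, the order of vanishing at `u₀` is even on the left and odd on the right.
theorem eq_zero_of_sq_eq_mul_sq {A B : ℂ[X]} {u₀ : ℂ} (h1 : h.rootMultiplicity u₀ = 1)
    (hAB : A ^ 2 = h * B ^ 2) : A = 0 ∧ B = 0 := by
  have hh : h ≠ 0 := by rintro rfl; simp at h1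
  by_cases hB : B = 0
  · subst hB
    simpa using hAB
  · exfalso
    have hA : A ≠ 0 := by
      rintro rfl
      have := mul_ne_zero hh (pow_ne_zero 2 hB)
      exact this (by rw [← hAB]; simp)
    have e := congrArg (rootMultiplicity u₀) hAB
    rw [rootMultiplicity_mul (mul_ne_zero hh (pow_ne_zero 2 hB)), h1, sq, sq,
      rootMultiplicity_mul (mul_ne_zero hA hA), rootMultiplicity_mul (mul_ne_zero hB hB)] at e
    omega

/-- If `h` has a simple root, then a regular function on `w² = h(u)` with infinitely many zeros
vanishes identically. -/
theorem IsRegularOn.eq_zero {u₀ : ℂ} (h1 : h.rootMultiplicity u₀ = 1) (hg : IsRegularOn h g)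
    (hinf : {e ∈ doubleCover h | g e = 0}.Infinite) : ∀ e ∈ doubleCover h, g e = 0 := by
  obtain ⟨A, B, hAB⟩ := hg
  have hinf' : (Prod.fst '' {e ∈ doubleCover h | g e = 0}).Infinite :=
    fun hf => hinf (finite_doubleCover_of_finite_fst (fun _ he => he.1) hf)
  -- This is the norm `(A + B w) (A - B w)`, a polynomial in `u` alone; it vanishes at the first
  -- coordinates of the zeros, and these are infinitely many because the fibres over `u` are finite.
  have e0 : A ^ 2 - h * B ^ 2 = 0 := by
    refine Polynomial.eq_zero_of_infinite_isRoot _ (hinf'.mono ?_)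
    rintro _ ⟨⟨u, w⟩, ⟨he, h0⟩, rfl⟩
    have he' : w ^ 2 = h.eval u := he
    have h0' := (hAB _ he).symm.trans h0
    simp only [Set.mem_ofPred_eq, Polynomial.IsRoot.def, Polynomial.eval_sub, Polynomial.eval_mul,
      Polynomial.eval_pow, ← he'] at h0' ⊢
    linear_combination (A.eval u - B.eval u * w) * h0'
  obtain ⟨rfl, rfl⟩ := eq_zero_of_sq_eq_mul_sq h1 (sub_eq_zero.1 e0)
  intro e he
  simp [hAB e he]

theorem infinite_doubleCover_of_ne_zero {b : Polynomial ℂ} (hb : b ≠ 0) :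
    {e ∈ doubleCover h | b.eval e.1 ≠ 0}.Infinite := by
  refine Set.Infinite.of_image Prod.fst ?_
  have : {u | b.IsRoot u}ᶜ.Infinite := (Polynomial.finite_setOfPred_isRoot hb).infinite_compl
  refine this.mono fun u hu => ?_
  obtain ⟨w, hw⟩ := IsAlgClosed.exists_pow_nat_eq (h.eval u) (n := 2) two_pos
  exact ⟨(u, w), ⟨hw, hu⟩, rfl⟩

/-- A family of parametrizations of `Z` by the curve `w² = h(u)`, one of which covers all but
finitely many points and is generically contained, up to reparametrization, in the others. -/
theorem vanishesOfInfinite_of_charts {n : ℕ} {Z : Set (CP n)} {J : Type*} {u₀ : ℂ}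
    (h1 : h.rootMultiplicity u₀ = 1) (Φ : J → ℂ × ℂ → Fin (n + 1) → ℂ) (j₀ : J)
    (hΦ : ∀ j i, IsRegularOn h (fun e => Φ j e i))
    (hfin : {p ∈ Z | ¬ ∃ e ∈ doubleCover h, ∃ r : ℂ, r ≠ 0 ∧ r • p.rep = Φ j₀ e}.Finite)
    (hcover : ∀ p ∈ Z, ∃ j, ∃ e ∈ doubleCover h, ∃ r : ℂ, r ≠ 0 ∧ r • p.rep = Φ j e)
    {b : Polynomial ℂ} (hb : b ≠ 0)
    (hj : ∀ j, ∀ e ∈ doubleCover h, b.eval e.1 ≠ 0 →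
      ∃ e' ∈ doubleCover h, ∃ r : ℂ, r ≠ 0 ∧ Φ j e = r • Φ j₀ e') :
    VanishesOfInfinite Z := by
  intro f k hf hinf
  have hinf' : ({p ∈ Z | eval p.rep f = 0} \
      {p ∈ Z | ¬ ∃ e ∈ doubleCover h, ∃ r : ℂ, r ≠ 0 ∧ r • p.rep = Φ j₀ e}).Infinite :=
    hinf.sdiff hfin
  -- Infinitely many zeros of `f` on `Z` lift through `Φ j₀`. Distinct points have distinct lifts,
  -- so the pullback of `f` has infinitely many zeros on the cover.
  have h0 : ∀ e ∈ doubleCover h, eval (Φ j₀ e) f = 0 := by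
    refine (IsRegularOn.eval (hΦ j₀) f).eq_zero h1 fun hE => hinf' ?_
    have hch : ∀ p ∈ ({p ∈ Z | eval p.rep f = 0} \
      {p ∈ Z | ¬ ∃ e ∈ doubleCover h, ∃ r : ℂ, r ≠ 0 ∧ r • p.rep = Φ j₀ e}),
        ∃ e ∈ doubleCover h, ∃ r : ℂ, r ≠ 0 ∧ r • p.rep = Φ j₀ e := by
      rintro p ⟨hp, hp'⟩
      by_contra hc
      exact hp' ⟨hp.1, hc⟩
    choose! E hE1 r hr hE2 using hch
    refine Set.Finite.of_finite_image (hE.subset ?_) (f := E) ?_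
    · rintro _ ⟨p, hp, rfl⟩
      refine ⟨hE1 p hp, ?_⟩
      rw [← hE2 p hp]
      exact (eval_smul_eq_zero_iff hf (hr p hp) _).2 hp.1.2
    · intro p hp q hq hpq
      have e1 := hE2 p hp
      rw [hpq, ← hE2 q hq] at e1
      rw [← p.mk_rep, ← q.mk_rep, Projectivization.mk_eq_mk_iff']
      refine ⟨(r p)⁻¹ * r q, ?_⟩
      rw [mul_smul, ← e1, smul_smul, inv_mul_cancel₀ (hr p hp), one_smul]
  -- Where `b ≠ 0`, an infinite set, the chart `Φ j` takes values of `Φ j₀` up to scale, so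
  -- vanishing carries over to it and then extends to the whole cover.
  have hall : ∀ j, ∀ e ∈ doubleCover h, eval (Φ j e) f = 0 := by
    intro j
    refine (IsRegularOn.eval (hΦ j) f).eq_zero h1 ((infinite_doubleCover_of_ne_zero (h := h) hb).mono ?_)
    rintro e ⟨he, hbe⟩
    obtain ⟨e', he', r, hr, heq⟩ := hj j e he hbe
    refine ⟨he, ?_⟩
    rw [heq]
    exact (eval_smul_eq_zero_iff hf hr _).2 (h0 e' he')
  intro p hp
  obtain ⟨j, e, he, r, hr, heq⟩ := hcover p hp
  rw [← eval_smul_eq_zero_iff hf hr, heq]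
  exact hall j e he

end DoubleCover

/-! ### Homogeneous equations and rational maps on explicit representatives. -/

section Maps

variable {m n : ℕ}

theorem mem_zeroLocus_pt {ι : Type} {F : ι → MvPolynomial (Fin (n + 1)) ℂ}
    (hF : ∀ i, ∃ k, (F i).IsHomogeneous k) (x : Fin (n + 1) → ℂ) (hx : x ≠ 0) :
    pt x hx ∈ zeroLocus F ↔ ∀ i, eval x (F i) = 0 := by
  obtain ⟨r, hr, h⟩ := rep_pt x hx
  refine forall_congr' fun i => ?_
  obtain ⟨k, hk⟩ := hF i
  rw [h]
  exact eval_smul_eq_zero_iff hk hr x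

theorem isOpen_rep_ne_zero {f : MvPolynomial (Fin (n + 1)) ℂ} {k : ℕ} (hf : f.IsHomogeneous k) :
    IsOpen {p : CP n | eval p.rep f ≠ 0} := by
  rw [← isClosed_compl_iff, isClosed_iff_isSubvariety]
  refine ⟨{f}, ?_, ?_⟩
  · rintro g rfl
    exact ⟨k, hf⟩
  · ext p
    simp

theorem RatMap.maps_of_eval_eq (φ : RatMap m n) {p : CP m} {q : CP n} {r : ℂ} (hr : r ≠ 0)
    (h : ∀ i, eval p.rep (φ.poly i) = r * q.rep i) : φ.Maps p q := by
  have h' : (fun i => eval p.rep (φ.poly i)) = r • q.rep := funext h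
  have h0 : (fun i => eval p.rep (φ.poly i)) ≠ 0 := by
    rw [h']
    exact smul_ne_zero hr q.rep_nonzero
  refine ⟨h0, ?_⟩
  symm
  rw [eq_pt_iff]
  refine ⟨r⁻¹, inv_ne_zero hr, ?_⟩
  rw [h', smul_smul, inv_mul_cancel₀ hr, one_smul]

theorem RatMap.maps_pt_of_eval_eq (φ : RatMap m n) {x : Fin (m + 1) → ℂ} {hx : x ≠ 0} {q : CP n}
    {r : ℂ} (hr : r ≠ 0) (h : ∀ i, eval x (φ.poly i) = r * q.rep i) : φ.Maps (pt x hx) q := by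
  obtain ⟨s, hs, hs'⟩ := rep_pt x hx
  refine φ.maps_of_eval_eq (mul_ne_zero (pow_ne_zero φ.degree hs) hr) fun i => ?_
  rw [hs', eval_smul_of_isHomogeneous (φ.homogeneous i), h, mul_assoc]

end Maps

/-! ### The defining equations -/

theorem isHomogeneous_Q₁ (a : ℝ) : (Q₁ a).IsHomogeneous 2 :=
  ((((isHomogeneous_C_mul_X _ _).sub (isHomogeneous_X _ _)).pow 2).add
    ((isHomogeneous_X _ _).pow 2)).sub ((isHomogeneous_X _ _).pow 2)

theorem isHomogeneous_Q₂ (a : ℝ) : (Q₂ a).IsHomogeneous 2 :=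
  ((((isHomogeneous_C_mul_X _ _).add (isHomogeneous_X _ _)).pow 2).add
    ((isHomogeneous_X _ _).pow 2)).sub ((isHomogeneous_X _ _).pow 2)

theorem isHomogeneous_L₁ (a : ℝ) (w : Fin 2 → ℂ) : (L₁ a w).IsHomogeneous 1 := by
  have := ((isHomogeneous_C (Fin 5) (w 0)).mul
    ((isHomogeneous_C_mul_X (a : ℂ) (0 : Fin 5)).sub (isHomogeneous_X ℂ 1))).sub
    (isHomogeneous_C_mul_X (w 1) 2)
  exact this

theorem isHomogeneous_L₂ (a : ℝ) (w : Fin 2 → ℂ) : (L₂ a w).IsHomogeneous 1 := by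
  have := ((isHomogeneous_C (Fin 5) (w 0)).mul
    ((isHomogeneous_C_mul_X (a : ℂ) (0 : Fin 5)).neg.sub (isHomogeneous_X ℂ 1))).sub
    (isHomogeneous_C_mul_X (w 1) 2)
  exact this

theorem isHomogeneous_hcEquations (a : ℝ) (v₁ v₂ : Fin 2 → ℂ) (d : ℂ) (i : Fin 3) :
    ∃ k, (hcEquations a v₁ v₂ d i).IsHomogeneous k := by
  refine ⟨2, ?_⟩
  fin_cases i
  · exact isHomogeneous_Q₁ a
  · exact isHomogeneous_Q₂ a
  · exact (((isHomogeneous_L₂ a v₂).mul (isHomogeneous_X _ _)).sub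
      ((isHomogeneous_L₁ a v₁).mul (isHomogeneous_X _ _))).sub
      ((isHomogeneous_C_mul_X d 3).mul (isHomogeneous_X _ 4))

theorem isHomogeneous_quarticPoly (v₁ v₂ : Fin 2 → ℂ) (d : ℂ) :
    (quarticPoly v₁ v₂ d).IsHomogeneous 4 := by
  have hX : ∀ i : Fin 3, (X i ^ 2 : MvPolynomial (Fin 3) ℂ).IsHomogeneous 2 :=
    fun i => (isHomogeneous_X ℂ i).pow 2
  have hC : ∀ (r : ℂ) (i j k l : Fin 3),
      (C r * (X i ^ 2 - X j ^ 2) * (X k ^ 2 + X l ^ 2)).IsHomogeneous 4 := fun r i j k l =>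
    (((isHomogeneous_C (Fin 3) r).mul ((hX i).sub (hX j))).mul ((hX k).add (hX l)))
  have hX' : ∀ (r : ℂ) (i j k l : Fin 3),
      (C r * X i * X j * (X k ^ 2 + X l ^ 2)).IsHomogeneous 4 := fun r i j k l =>
    (((isHomogeneous_C_mul_X r i).mul (isHomogeneous_X ℂ j)).mul ((hX k).add (hX l)))
  have hd : (C d * (X 1 ^ 2 + X 2 ^ 2) * (X 0 ^ 2 + X 2 ^ 2) : MvPolynomial (Fin 3) ℂ).IsHomogeneous 4 :=
    ((isHomogeneous_C (Fin 3) d).mul ((hX 1).add (hX 2))).mul ((hX 0).add (hX 2))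
  exact ((((hX' _ _ _ _ _).sub (hX' _ _ _ _ _)).add (hC _ _ _ _ _)).sub (hC _ _ _ _ _)).sub hd

theorem eval_hcEquations {a : ℝ} {v d : ℂ} (hv : v ≠ 0) (x : Fin 5 → ℂ) :
    (∀ i, eval x (hcEquations a ![0, v] ![0, v] d i) = 0) ↔
      (a * x 0 - x 1) ^ 2 + x 2 ^ 2 = x 3 ^ 2 ∧ (a * x 0 + x 1) ^ 2 + x 2 ^ 2 = x 4 ^ 2 ∧
        x 2 * (x 4 - x 3) = d / v * x 3 * x 4 := by
  rw [Fin.forall_fin_succ, Fin.forall_fin_succ, Fin.forall_fin_one]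
  simp only [hcEquations, Q₁, Q₂, fdoaPoly, L₁, L₂, Matrix.cons_val_zero, Matrix.cons_val_one,
    Matrix.cons_val_succ, Matrix.cons_val_fin_one, map_sub, map_add, map_mul, map_pow, map_neg, eval_C, eval_X]
  refine and_congr sub_eq_zero (and_congr sub_eq_zero ?_)
  field_simp
  rw [← sub_eq_zero (a := v * _ * _)]
  exact Eq.congr_left (by ring)

theorem mem_HCF {a : ℝ} {v d : ℂ} (hv : v ≠ 0) (p : CP 4) :
    p ∈ HCF a ![0, v] ![0, v] d ↔
      (a * p.rep 0 - p.rep 1) ^ 2 + p.rep 2 ^ 2 = p.rep 3 ^ 2 ∧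
      (a * p.rep 0 + p.rep 1) ^ 2 + p.rep 2 ^ 2 = p.rep 4 ^ 2 ∧
        p.rep 2 * (p.rep 4 - p.rep 3) = d / v * p.rep 3 * p.rep 4 :=
  eval_hcEquations hv p.rep

theorem pt_mem_HCF {a : ℝ} {v d : ℂ} (hv : v ≠ 0) (x : Fin 5 → ℂ) (hx : x ≠ 0) :
    pt x hx ∈ HCF a ![0, v] ![0, v] d ↔
      (a * x 0 - x 1) ^ 2 + x 2 ^ 2 = x 3 ^ 2 ∧ (a * x 0 + x 1) ^ 2 + x 2 ^ 2 = x 4 ^ 2 ∧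
        x 2 * (x 4 - x 3) = d / v * x 3 * x 4 :=
  (mem_zeroLocus_pt (isHomogeneous_hcEquations _ _ _ _) x hx).trans (eval_hcEquations hv x)

theorem eval_quarticPoly {v d : ℂ} (hv : v ≠ 0) (x : Fin 3 → ℂ) :
    eval x (quarticPoly ![0, v] ![0, v] d) = 0 ↔
      2 * x 0 * x 2 * (x 1 ^ 2 + x 2 ^ 2) - 2 * x 1 * x 2 * (x 0 ^ 2 + x 2 ^ 2) =
        d / v * (x 1 ^ 2 + x 2 ^ 2) * (x 0 ^ 2 + x 2 ^ 2) := by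
  simp only [quarticPoly, Matrix.cons_val_zero, Matrix.cons_val_one,
    Matrix.cons_val_fin_one, map_sub, map_add, map_mul, map_pow, eval_C, eval_X]
  field_simp
  constructor <;> intro h <;> linear_combination h

theorem mem_planeQuartic {v d : ℂ} (hv : v ≠ 0) (p : CP 2) :
    p ∈ planeQuartic ![0, v] ![0, v] d ↔
      2 * p.rep 0 * p.rep 2 * (p.rep 1 ^ 2 + p.rep 2 ^ 2)
          - 2 * p.rep 1 * p.rep 2 * (p.rep 0 ^ 2 + p.rep 2 ^ 2) =
        d / v * (p.rep 1 ^ 2 + p.rep 2 ^ 2) * (p.rep 0 ^ 2 + p.rep 2 ^ 2) :=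
  (forall_const _).trans (eval_quarticPoly hv p.rep)

theorem pt_mem_planeQuartic {v d : ℂ} (hv : v ≠ 0) (x : Fin 3 → ℂ) (hx : x ≠ 0) :
    pt x hx ∈ planeQuartic ![0, v] ![0, v] d ↔
      2 * x 0 * x 2 * (x 1 ^ 2 + x 2 ^ 2) - 2 * x 1 * x 2 * (x 0 ^ 2 + x 2 ^ 2) =
        d / v * (x 1 ^ 2 + x 2 ^ 2) * (x 0 ^ 2 + x 2 ^ 2) :=
  ((mem_zeroLocus_pt (fun _ => ⟨4, isHomogeneous_quarticPoly _ _ _⟩) x hx).trans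
    (forall_const _)).trans (eval_quarticPoly hv x)

/-! ### The double cover parametrizing both curves -/

section Cover

open Polynomial

/-- `c u² + 2 u + c`. -/
def slopePoly (c : ℂ) : ℂ[X] := Polynomial.C c * Polynomial.X ^ 2 + 2 * Polynomial.X + Polynomial.C c

/-- `(1 + u²)² - (c u² + 2 u + c)²`. -/
def coverPoly (c : ℂ) : ℂ[X] := (1 + Polynomial.X ^ 2) ^ 2 - slopePoly c ^ 2

theorem eval_slopePoly (c u : ℂ) : (slopePoly c).eval u = c * u ^ 2 + 2 * u + c := by
  simp [slopePoly]

theorem eval_coverPoly (c u : ℂ) :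
    (coverPoly c).eval u = (1 + u ^ 2) ^ 2 - (c * u ^ 2 + 2 * u + c) ^ 2 := by
  simp [coverPoly, eval_slopePoly]

theorem slopePoly_ne_zero {c : ℂ} (hc : c ≠ 0) : slopePoly c ≠ 0 := by
  intro h
  have := eval_slopePoly c 0
  rw [h] at this
  simp [hc.symm] at this

theorem exists_slopePoly_root {c : ℂ} (hc : c ≠ 0) : ∃ u : ℂ, u ≠ 0 ∧ c * u ^ 2 + 2 * u + c = 0 := by
  obtain ⟨s, hs⟩ := IsAlgClosed.exists_pow_nat_eq (1 - c ^ 2) (n := 2) two_pos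
  have h : c * ((s - 1) / c) ^ 2 + 2 * ((s - 1) / c) + c = 0 := by
    field_simp
    linear_combination hs
  refine ⟨_, ?_, h⟩
  intro h0
  rw [h0] at h
  simp [hc] at h

theorem one_add_sq_ne_zero_of_slope {c u : ℂ} (h : c * u ^ 2 + 2 * u + c = 0) : 1 + u ^ 2 ≠ 0 := by
  intro h0
  have hu : u = 0 := by linear_combination (h - c * h0) / 2
  rw [hu] at h0
  norm_num at h0

theorem rootMultiplicity_eq_one {p : ℂ[X]} {u : ℂ} (h0 : p.eval u = 0)
    (h1 : p.derivative.eval u ≠ 0) : p.rootMultiplicity u = 1 := by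
  have hp : p ≠ 0 := by rintro rfl; simp at h1
  have := (rootMultiplicity_pos hp).2 h0
  have := mt (fun h => ((one_lt_rootMultiplicity_iff_isRoot hp).1 h).2) h1
  omega

theorem derivative_eval_coverPoly (c u : ℂ) : (coverPoly c).derivative.eval u =
    4 * u * (1 + u ^ 2) - 4 * (c * u ^ 2 + 2 * u + c) * (c * u + 1) := by
  simp [coverPoly, slopePoly, derivative_pow]
  ring

/-- The polynomial factors as `(N - M) (N + M)`. For `e = ±1` the factor `N - e M = (1 - e c) u² - 2
e u + (1 - e c)` has reduced discriminant `e c (2 - e c)`, and `2 - e c` is nonzero for at least one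
sign. The other factor does not vanish at that root, since `N` and `M` have no common zero. -/
theorem exists_simple_root_coverPoly {c : ℂ} (hc : c ≠ 0) :
    ∃ u, (coverPoly c).rootMultiplicity u = 1 := by
  have key : ∀ e : ℂ, e ^ 2 = 1 → 2 - e * c ≠ 0 →
      ∃ u, (coverPoly c).rootMultiplicity u = 1 := by
    intro e he hec
    have he0 : e ≠ 0 := by rintro rfl; norm_num at he
    obtain ⟨u, hu⟩ : ∃ u : ℂ, (1 - e * c) * u ^ 2 - 2 * e * u + (1 - e * c) = 0 := by
      -- When the leading coefficient vanishes the factor is linear, with root `0`.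
      by_cases h1 : 1 - e * c = 0
      · exact ⟨0, by simp [h1]⟩
      · obtain ⟨s, hs⟩ := IsAlgClosed.exists_pow_nat_eq (e * c * (2 - e * c)) (n := 2) two_pos
        refine ⟨(e + s) / (1 - e * c), ?_⟩
        field_simp
        linear_combination hs - he
    refine ⟨u, rootMultiplicity_eq_one ?_ ?_⟩
    · rw [eval_coverPoly]
      linear_combination ((1 + u ^ 2) + e * (c * u ^ 2 + 2 * u + c)) * hu
        + (c * u ^ 2 + 2 * u + c) ^ 2 * he
    · rw [derivative_eval_coverPoly]
      intro h
      have hN : 1 + u ^ 2 ≠ 0 := by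
        intro h0
        have : u = 0 := by
          have : e * u = 0 := by linear_combination ((1 - e * c) * h0 - hu) / 2
          exact (mul_eq_zero.1 this).resolve_left he0
        rw [this] at h0
        norm_num at h0
      have hM : c * u ^ 2 + 2 * u + c = e * (1 + u ^ 2) := by
        linear_combination -e * hu - (c * u ^ 2 + c + 2 * u) * he
      have h2 : (1 + u ^ 2) * (u - e * (c * u + 1)) = 0 := by
        rw [hM] at h
        linear_combination h / 4
      have h3 := (mul_eq_zero.1 h2).resolve_left hN
      have h4 : (e * c) * (2 - e * c) = 0 := by
        linear_combination ((1 - e * c) * u - e) * h3 - (1 - e * c) * hu - he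
      exact (mul_ne_zero (mul_ne_zero he0 hc) hec) h4
  by_cases h2 : 2 - 1 * c = 0
  · refine key (-1) (by norm_num) fun h => ?_
    have : (4 : ℂ) = 0 := by linear_combination h2 + h
    norm_num at this
  · exact key 1 (by norm_num) h2

theorem mem_doubleCover_coverPoly {c u w : ℂ} : (u, w) ∈ doubleCover (coverPoly c) ↔
    w ^ 2 = (1 + u ^ 2) ^ 2 - (c * u ^ 2 + 2 * u + c) ^ 2 := by
  simp [doubleCover, eval_coverPoly]

/-- `N` and `M` are palindromic, so `(u, w) ↦ (1/u, w/u²)` is a symmetry of the cover. It relates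
the charts that differ at `u = 0`. -/
theorem inv_mem_doubleCover_coverPoly {c u w : ℂ} (hu : u ≠ 0)
    (h : (u, w) ∈ doubleCover (coverPoly c)) :
    (u⁻¹, w / u ^ 2) ∈ doubleCover (coverPoly c) := by
  rw [mem_doubleCover_coverPoly] at *
  field_simp
  linear_combination h

end Cover

section Regular

variable {h : Polynomial ℂ} {g g' : ℂ × ℂ → ℂ}

theorem isRegularOn_const (r : ℂ) : IsRegularOn h (fun _ => r) := by
  simpa using isRegularOn_poly (h := h) (Polynomial.C r)

theorem isRegularOn_fst : IsRegularOn h (fun e => e.1) := by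
  simpa using isRegularOn_poly (h := h) Polynomial.X

theorem IsRegularOn.sub (hg : IsRegularOn h g) (hg' : IsRegularOn h g') :
    IsRegularOn h (fun e => g e - g' e) := by
  simpa [sub_eq_add_neg] using hg.add ((isRegularOn_const (-1)).mul hg')

theorem isRegularOn_slope (c : ℂ) :
    IsRegularOn h (fun e => c * e.1 ^ 2 + 2 * e.1 + c) := by
  simpa [eval_slopePoly] using isRegularOn_poly (h := h) (slopePoly c)

theorem isRegularOn_one_add_sq : IsRegularOn h (fun e => 1 + e.1 ^ 2) :=
  ⟨1 + Polynomial.X ^ 2, 0, fun e _ => by simp⟩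

theorem isRegularOn_one_sub_sq : IsRegularOn h (fun e => 1 - e.1 ^ 2) :=
  ⟨1 - Polynomial.X ^ 2, 0, fun e _ => by simp⟩

end Regular

/-! ### The plane quartic -/

/-- Three parametrizations of the plane quartic. -/
def quarticChart (c : ℂ) : Fin 3 → ℂ × ℂ → Fin 3 → ℂ :=
  ![fun e => ![c * e.1 ^ 2 + 2 * e.1 + c, e.1 * (1 + e.1 ^ 2 - e.2), 1 + e.1 ^ 2 - e.2],
    fun e => ![1 + e.1 ^ 2 + e.2, e.1 * (c * e.1 ^ 2 + 2 * e.1 + c), c * e.1 ^ 2 + 2 * e.1 + c],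
    fun e => ![e.1 * (c * e.1 ^ 2 + 2 * e.1 + c), 1 + e.1 ^ 2 - e.2, e.1 * (1 + e.1 ^ 2 - e.2)]]

theorem isRegularOn_quarticChart {h : Polynomial ℂ} (c : ℂ) (j i : Fin 3) :
    IsRegularOn h (fun e => quarticChart c j e i) := by
  have hM := isRegularOn_slope (h := h) c
  have hN := isRegularOn_one_add_sq (h := h)
  have hw := isRegularOn_snd (h := h)
  have hu := isRegularOn_fst (h := h)
  fin_cases j <;> fin_cases i
  · exact hM
  · exact hu.mul (hN.sub hw)
  · exact hN.sub hw
  · exact hN.add hw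
  · exact hu.mul hM
  · exact hM
  · exact hu.mul hM
  · exact hN.sub hw
  · exact hu.mul (hN.sub hw)

/-- Chart 0 encodes the root `s = M / (N - w)` of `M s² - 2 N s + M`, so `w` is found as `N - M /
s`. For `s = 0` one has `M = 0`, and `w = -N` is the branch on which the chart does not vanish. -/
theorem exists_quarticChart_zero {v d : ℂ} (hv : v ≠ 0) {p : CP 2}
    (hp : p ∈ planeQuartic ![0, v] ![0, v] d) (h2 : p.rep 2 ≠ 0) :
    ∃ e ∈ doubleCover (coverPoly (d / v)), ∃ r : ℂ, r ≠ 0 ∧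
      r • p.rep = quarticChart (d / v) 0 e := by
  rw [mem_planeQuartic hv] at hp
  generalize d / v = c at *
  generalize p.rep = x at *
  by_cases h0 : x 0 = 0
  · have hM : c * (x 1 / x 2) ^ 2 + 2 * (x 1 / x 2) + c = 0 := by
      rw [h0] at hp
      field_simp
      have : x 2 ^ 2 * (c * x 1 ^ 2 + 2 * x 1 * x 2 + c * x 2 ^ 2) = 0 := by
        linear_combination -hp
      linear_combination (mul_eq_zero.1 this).resolve_left (pow_ne_zero 2 h2)
    have hN := one_add_sq_ne_zero_of_slope hM
    refine ⟨(x 1 / x 2, -(1 + (x 1 / x 2) ^ 2)), ?_, 2 * (1 + (x 1 / x 2) ^ 2) / x 2,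
      div_ne_zero (mul_ne_zero two_ne_zero hN) h2, ?_⟩
    · rw [mem_doubleCover_coverPoly, hM]
      ring
    · ext i
      fin_cases i <;> simp [quarticChart, hM, h0] <;> field_simp <;> ring
  · have hx : (x 1 ^ 2 + x 2 ^ 2) * (2 * x 0 * x 2) =
        (c * x 1 ^ 2 + 2 * x 1 * x 2 + c * x 2 ^ 2) * (x 0 ^ 2 + x 2 ^ 2) := by
      linear_combination hp
    have hM : c * (x 1 / x 2) ^ 2 + 2 * (x 1 / x 2) + c ≠ 0 := by
      intro hM
      have hN := one_add_sq_ne_zero_of_slope hM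
      have e1 : c * x 1 ^ 2 + 2 * x 1 * x 2 + c * x 2 ^ 2 = 0 := by
        field_simp at hM
        linear_combination hM
      rw [e1, zero_mul] at hx
      apply hN
      field_simp
      linear_combination (mul_eq_zero.1 hx).resolve_right (by simp [h0, h2])
    refine ⟨(x 1 / x 2, 1 + (x 1 / x 2) ^ 2 -
      (c * (x 1 / x 2) ^ 2 + 2 * (x 1 / x 2) + c) * x 2 / x 0), ?_,
      (c * (x 1 / x 2) ^ 2 + 2 * (x 1 / x 2) + c) / x 0, div_ne_zero hM h0, ?_⟩
    · rw [mem_doubleCover_coverPoly]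
      field_simp
      linear_combination (-(c * x 1 ^ 2 + 2 * x 1 * x 2 + c * x 2 ^ 2)) * hx
    · ext i
      fin_cases i <;> simp [quarticChart] <;> field_simp

theorem exists_quarticChart {v d : ℂ} (hv : v ≠ 0) (hd : d ≠ 0) {p : CP 2}
    (hp : p ∈ planeQuartic ![0, v] ![0, v] d) :
    ∃ j, ∃ e ∈ doubleCover (coverPoly (d / v)), ∃ r : ℂ, r ≠ 0 ∧
      r • p.rep = quarticChart (d / v) j e := by
  by_cases h2 : p.rep 2 = 0
  · have hc : d / v ≠ 0 := div_ne_zero hd hv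
    have hrep := p.rep_nonzero
    rw [mem_planeQuartic hv] at hp
    generalize d / v = c at *
    generalize p.rep = x at *
    have h01 : x 0 = 0 ∨ x 1 = 0 := by
      by_contra! h
      have : c * x 1 ^ 2 * x 0 ^ 2 = 0 := by
        rw [h2] at hp
        linear_combination -hp
      exact mul_ne_zero (mul_ne_zero hc (pow_ne_zero 2 h.2)) (pow_ne_zero 2 h.1) this
    rcases h01 with h0 | h1
    · have h1 : x 1 ≠ 0 := by
        intro h1
        apply hrep
        ext i
        fin_cases i <;> assumption
      -- The point `[0, 1, 0]` lies at `u = ∞` of chart 0, that is, at `u = 0` of chart 2.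
      obtain ⟨w, hw⟩ := IsAlgClosed.exists_pow_nat_eq (1 - c ^ 2) (n := 2) two_pos
      have hw1 : 1 - w ≠ 0 := by
        intro h
        apply pow_ne_zero 2 hc
        linear_combination (1 + w) * h + hw
      refine ⟨2, (0, w), ?_, (1 - w) / x 1, div_ne_zero hw1 h1, ?_⟩
      · rw [mem_doubleCover_coverPoly]
        linear_combination hw
      · ext i
        fin_cases i <;> simp [quarticChart, h0, h2, h1]
    · have h0 : x 0 ≠ 0 := by
        intro h0
        apply hrep
        ext i
        fin_cases i <;> assumption
      -- The point `[1, 0, 0]` is `s = ∞`: a root of `M` on the branch `w = N`, where chart 0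
      -- vanishes but chart 1 does not.
      obtain ⟨u, -, hM⟩ := exists_slopePoly_root hc
      have hN := one_add_sq_ne_zero_of_slope hM
      refine ⟨1, (u, 1 + u ^ 2), ?_, 2 * (1 + u ^ 2) / x 0,
        div_ne_zero (mul_ne_zero two_ne_zero hN) h0, ?_⟩
      · rw [mem_doubleCover_coverPoly, hM]
        ring
      · ext i
        fin_cases i <;> simp [quarticChart, hM, h1, h2]
        field_simp
        ring
  · exact ⟨0, exists_quarticChart_zero hv hp h2⟩

theorem vanishesOfInfinite_planeQuartic {v d : ℂ} (hv : v ≠ 0) (hd : d ≠ 0) :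
    VanishesOfInfinite (planeQuartic ![0, v] ![0, v] d) := by
  have hc : d / v ≠ 0 := div_ne_zero hd hv
  obtain ⟨u₀, hu₀⟩ := exists_simple_root_coverPoly hc
  refine vanishesOfInfinite_of_charts hu₀ (quarticChart (d / v)) 0
    (isRegularOn_quarticChart (d / v)) ?_ (fun p hp => exists_quarticChart hv hd hp)
    (b := Polynomial.X * slopePoly (d / v))
    (mul_ne_zero Polynomial.X_ne_zero (slopePoly_ne_zero hc)) ?_
  · refine ((Set.finite_singleton (pt ![0, 1, 0] (fun h => by simpa using congrFun h 1) : CP 2)).insert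
      (pt ![1, 0, 0] (fun h => by simpa using congrFun h 0))).subset ?_
    rintro p ⟨hp, hp'⟩
    have h2 : p.rep 2 = 0 := by
      by_contra h2
      exact hp' (exists_quarticChart_zero hv hp h2)
    have hrep := p.rep_nonzero
    simp only [Set.mem_insert_iff, Set.mem_singleton_iff, eq_pt_iff]
    rw [mem_planeQuartic hv] at hp
    have h01 : p.rep 0 = 0 ∨ p.rep 1 = 0 := by
      by_contra! h
      have : d / v * p.rep 1 ^ 2 * p.rep 0 ^ 2 = 0 := by
        rw [h2] at hp
        linear_combination -hp
      exact mul_ne_zero (mul_ne_zero hc (pow_ne_zero 2 h.2)) (pow_ne_zero 2 h.1) this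
    generalize p.rep = x at *
    rcases h01 with h0 | h1
    · right
      refine ⟨x 1, fun h1 => hrep ?_, ?_⟩ <;> ext i <;> fin_cases i <;> simp [h0, h2]
      exact h1
    · left
      refine ⟨x 0, fun h0 => hrep ?_, ?_⟩ <;> ext i <;> fin_cases i <;> simp [h1, h2]
      exact h0
  · rintro j ⟨u, w⟩ he hb
    simp only [Polynomial.eval_mul, Polynomial.eval_X, eval_slopePoly] at hb
    have hu := left_ne_zero_of_mul hb
    have hM := right_ne_zero_of_mul hb
    generalize d / v = c at *
    fin_cases j
    · exact ⟨_, he, 1, one_ne_zero, by simp⟩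
    · have he' := mem_doubleCover_coverPoly.1 he
      have hNw : 1 + u ^ 2 - w ≠ 0 := by
        intro h
        apply pow_ne_zero 2 hM
        linear_combination (1 + u ^ 2 + w) * h + he'
      -- Charts 0 and 1 are proportional because `M² = (N - w) (N + w)`.
      refine ⟨_, he, (c * u ^ 2 + 2 * u + c) / (1 + u ^ 2 - w), div_ne_zero hM hNw, ?_⟩
      ext i
      fin_cases i <;> simp [quarticChart] <;> field_simp
      linear_combination -he'
    · refine ⟨_, inv_mem_doubleCover_coverPoly hu he, u ^ 3, pow_ne_zero 3 hu, ?_⟩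
      ext i
      fin_cases i <;> simp [quarticChart] <;> field_simp <;> ring

theorem infinite_planeQuartic_inter {v d : ℂ} (hv : v ≠ 0) (hd : d ≠ 0) :
    (planeQuartic ![0, v] ![0, v] d ∩
      {q | eval q.rep (X 0 * X 1 * X 2 : MvPolynomial (Fin 3) ℂ) ≠ 0}).Infinite := by
  have hc : d / v ≠ 0 := div_ne_zero hd hv
  refine Set.Infinite.of_image (fun q => q.rep 1 / q.rep 2) ?_
  refine (Polynomial.finite_setOfPred_isRoot (mul_ne_zero Polynomial.X_ne_zero
    (slopePoly_ne_zero hc))).infinite_compl.mono fun u hu => ?_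
  simp only [Set.mem_compl_iff, Set.mem_ofPred_eq, Polynomial.IsRoot.def, Polynomial.eval_mul,
    Polynomial.eval_X, eval_slopePoly] at hu
  have hu0 := left_ne_zero_of_mul hu
  have hM := right_ne_zero_of_mul hu
  obtain ⟨w, hw⟩ := IsAlgClosed.exists_pow_nat_eq
    ((1 + u ^ 2) ^ 2 - (d / v * u ^ 2 + 2 * u + d / v) ^ 2) (n := 2) two_pos
  have hNw : 1 + u ^ 2 - w ≠ 0 := by
    intro h
    apply pow_ne_zero 2 hM
    linear_combination (1 + u ^ 2 + w) * h + hw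
  have hx : quarticChart (d / v) 0 (u, w) ≠ 0 := fun h => hNw (congrFun h 2)
  obtain ⟨r, hr, hr'⟩ := rep_pt _ hx
  refine ⟨pt _ hx, ⟨?_, ?_⟩, ?_⟩
  · rw [pt_mem_planeQuartic hv]
    simp [quarticChart]
    generalize d / v = c at *
    linear_combination -(c * u ^ 2 + 2 * u + c) * (1 + u ^ 2 - w) ^ 2 * hw
  · simp only [Set.mem_ofPred_eq, map_mul, eval_X, hr', Pi.smul_apply]
    simp [hr, quarticChart, hu0, hM, hNw]
  · simp only [hr', Pi.smul_apply]
    simp [quarticChart]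
    field_simp

/-! ### The Ho-Chen curve -/

/-- Two parametrizations of the Ho-Chen curve. -/
def hcChart (a : ℝ) (c : ℂ) (s : ℤˣ) (e : ℂ × ℂ) : Fin 5 → ℂ :=
  ![(s : ℤ) * ((1 - e.1 ^ 2) * (c * e.1 ^ 2 + 2 * e.1 + c)) - 2 * e.1 * e.2,
    -a * ((s : ℤ) * ((1 - e.1 ^ 2) * (c * e.1 ^ 2 + 2 * e.1 + c)) + 2 * e.1 * e.2),
    -2 * a * (2 * e.1 * (c * e.1 ^ 2 + 2 * e.1 + c)),
    2 * a * ((c * e.1 ^ 2 + 2 * e.1 + c) * (1 + e.1 ^ 2)),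
    2 * a * (2 * e.1 * (1 + e.1 ^ 2))]

theorem isRegularOn_hcChart {h : Polynomial ℂ} (a : ℝ) (c : ℂ) (s : ℤˣ) (i : Fin 5) :
    IsRegularOn h (fun e => hcChart a c s e i) := by
  have hM := isRegularOn_slope (h := h) c
  have hN := isRegularOn_one_add_sq (h := h)
  have hK := (isRegularOn_const (h := h) (s : ℤ)).mul (isRegularOn_one_sub_sq.mul hM)
  have hu := (isRegularOn_const (h := h) 2).mul isRegularOn_fst
  have hw := hu.mul (isRegularOn_snd (h := h))
  fin_cases i
  · exact hK.sub hw
  · exact (isRegularOn_const _).mul (hK.add hw)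
  · exact (isRegularOn_const _).mul (hu.mul hM)
  · exact (isRegularOn_const _).mul (hM.mul hN)
  · exact (isRegularOn_const _).mul (hu.mul hN)

/-- At `u = 0` the chart with sign `1` passes through `p₂`; `p₁` is left to the chart with sign
`-1`. -/
theorem exists_hcChart {a : ℝ} (ha : 0 < a) {v d : ℂ} (hv : v ≠ 0) (hd : d ≠ 0) {p : CP 4}
    (hp : p ∈ HCF a ![0, v] ![0, v] d) : p = p₁ a ∨
    ∃ e ∈ doubleCover (coverPoly (d / v)), ∃ r : ℂ, r ≠ 0 ∧
      r • p.rep = hcChart a (d / v) 1 e := by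
  have ha' : (a : ℂ) ≠ 0 := by exact_mod_cast ha.ne'
  have hc : d / v ≠ 0 := div_ne_zero hd hv
  have hrep := p.rep_nonzero
  rw [p₁, eq_pt_iff]
  rw [mem_HCF hv] at hp
  generalize d / v = c at *
  generalize p.rep = x at *
  obtain ⟨h1, h2, h3⟩ := hp
  by_cases hy : x 2 = 0
  · simp only [hy, zero_mul, ne_eq, OfNat.ofNat_ne_zero, not_false_eq_true, zero_pow, add_zero] at h1 h2 h3
    by_cases hr1 : x 3 = 0
    · right
      have hx1 : x 1 = a * x 0 := by
        rw [hr1] at h1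
        linear_combination -(pow_eq_zero_iff two_ne_zero).1 (h1.trans (zero_pow two_ne_zero))
      have hr2 : x 4 ≠ 0 := by
        intro hr2
        have h0 : x 0 = 0 := by
          rw [hr2, hx1] at h2
          have : 2 * a * x 0 = 0 := by
            linear_combination (pow_eq_zero_iff two_ne_zero).1 (h2.trans (zero_pow two_ne_zero))
          simpa [ha'] using this
        apply hrep
        ext i
        fin_cases i <;> simp [hy, hr1, hr2, hx1, h0]
      -- Points with `y₂ = r₁ = 0` lie over a root of `M`, where `w = ±N`; the sign is that of `-(a
      -- t + y₁) / r₂`.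
      obtain ⟨u, hu, hM⟩ := exists_slopePoly_root hc
      have hN := one_add_sq_ne_zero_of_slope hM
      refine ⟨(u, -(1 + u ^ 2) * (a * x 0 + x 1) / x 4), ?_, 4 * a * u * (1 + u ^ 2) / x 4,
        div_ne_zero (by simp [ha', hu, hN]) hr2, ?_⟩
      · rw [mem_doubleCover_coverPoly, hM]
        field_simp
        linear_combination (1 + u ^ 2) ^ 2 * h2
      · ext i
        fin_cases i <;> simp [hcChart, hM, hy, hr1, hx1] <;> field_simp <;> ring
    · have hr2 : x 4 = 0 := by
        have := h3.symm
        simpa [hc, hr1] using this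
      have hx1 : x 1 = -a * x 0 := by
        rw [hr2] at h2
        linear_combination (pow_eq_zero_iff two_ne_zero).1 (h2.trans (zero_pow two_ne_zero))
      have h0 : x 0 ≠ 0 := by
        intro h0
        apply hr1
        rw [hx1, h0] at h1
        simpa using h1.symm
      rw [hx1] at h1
      have : (x 3 - 2 * a * x 0) * (x 3 + 2 * a * x 0) = 0 := by linear_combination -h1
      rcases mul_eq_zero.1 this with h | h
      · right
        obtain ⟨w, hw⟩ := IsAlgClosed.exists_pow_nat_eq (1 - c ^ 2) (n := 2) two_pos
        refine ⟨(0, w), ?_, c / x 0, div_ne_zero hc h0, ?_⟩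
        · rw [mem_doubleCover_coverPoly]
          linear_combination hw
        · ext i
          fin_cases i <;> simp [hcChart, hy, hr2, hx1] <;> field_simp
          linear_combination h
      · left
        refine ⟨x 0, h0, ?_⟩
        ext i
        fin_cases i <;> simp [hy, hr2, hx1]
        · ring
        · linear_combination h
  · right
    generalize hyy : x 2 = y at *
    generalize hrr1 : x 3 = r1 at *
    generalize hrr2 : x 4 = r2 at *
    -- `u` is the rational parameter of the first conic. It gives `N y = -2 u r1`; the FDOA equation
    -- then gives `M r2 = -N y`, and with `w = M (a t + y₁) / y` the second conic reads `w² = N² -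
    -- M²`.
    obtain ⟨u, hu⟩ : ∃ u, u * y = -(r1 - (a * x 0 - x 1)) :=
      ⟨-(r1 - (a * x 0 - x 1)) / y, div_mul_cancel₀ _ hy⟩
    have hu2 : u * (r1 + (a * x 0 - x 1)) = -y := by
      apply mul_left_cancel₀ hy
      linear_combination (r1 + (a * x 0 - x 1)) * hu + h1
    have hu0 : u ≠ 0 := by
      rintro rfl
      apply hy
      linear_combination hu2
    have hN : (1 + u ^ 2) * y = -2 * r1 * u := by linear_combination u * hu + hu2
    have hMy : (c * u ^ 2 + 2 * u + c) * y = 2 * u * (y - c * r1) := by linear_combination c * hN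
    have hMr : (c * u ^ 2 + 2 * u + c) * r2 = -(1 + u ^ 2) * y := by
      apply mul_left_cancel₀ hy
      linear_combination r2 * hMy + 2 * u * h3 + y * hN
    have hM : c * u ^ 2 + 2 * u + c ≠ 0 := by
      intro hM
      rw [hM, zero_mul] at hMr hMy
      have h0 : y - c * r1 = 0 := (mul_eq_zero.1 hMy.symm).resolve_left (by simpa using hu0)
      have hr1 : r1 = 0 := by
        have : y * r1 = 0 := by linear_combination r2 * h0 - h3
        exact (mul_eq_zero.1 this).resolve_left hy
      apply hy
      linear_combination h0 + c * hr1
    obtain ⟨w, hw⟩ : ∃ w, w * y = (c * u ^ 2 + 2 * u + c) * (a * x 0 + x 1) :=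
      ⟨_, div_mul_cancel₀ _ hy⟩
    obtain ⟨r, hr⟩ : ∃ r, r * y = -4 * a * u * (c * u ^ 2 + 2 * u + c) :=
      ⟨_, div_mul_cancel₀ _ hy⟩
    refine ⟨(u, w), ?_, r, ?_, ?_⟩
    · rw [mem_doubleCover_coverPoly]
      generalize c * u ^ 2 + 2 * u + c = M at *
      apply mul_left_cancel₀ (pow_ne_zero 2 hy)
      linear_combination (w * y + M * (a * x 0 + x 1)) * hw + M ^ 2 * h2
        + (M * r2 - (1 + u ^ 2) * y) * hMr
    · rintro rfl
      rw [zero_mul] at hr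
      exact mul_ne_zero (mul_ne_zero (mul_ne_zero (by norm_num) ha') hu0) hM hr.symm
    · generalize hMM : c * u ^ 2 + 2 * u + c = M at *
      have hu3 : (1 - u ^ 2) * y = -2 * u * (a * x 0 - x 1) := by linear_combination -u * hu + hu2
      ext i
      apply mul_left_cancel₀ hy
      fin_cases i <;> simp [hcChart, hMM, hyy, hrr1, hrr2, -mul_eq_mul_left_iff]
      · linear_combination x 0 * hr - M * hu3 + 2 * u * hw
      · linear_combination x 1 * hr + a * M * hu3 + 2 * a * u * hw
      · linear_combination y * hr
      · linear_combination r1 * hr - 2 * a * M * hN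
      · linear_combination r2 * hr - 4 * a * u * hMr

theorem vanishesOfInfinite_HCF {a : ℝ} (ha : 0 < a) {v d : ℂ} (hv : v ≠ 0) (hd : d ≠ 0) :
    VanishesOfInfinite (HCF a ![0, v] ![0, v] d) := by
  have ha' : (a : ℂ) ≠ 0 := by exact_mod_cast ha.ne'
  have hc : d / v ≠ 0 := div_ne_zero hd hv
  obtain ⟨u₀, hu₀⟩ := exists_simple_root_coverPoly hc
  refine vanishesOfInfinite_of_charts hu₀ (hcChart a (d / v)) 1
    (isRegularOn_hcChart a (d / v)) ?_ ?_ (b := Polynomial.X) Polynomial.X_ne_zero ?_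
  · refine (Set.finite_singleton (p₁ a)).subset ?_
    rintro p ⟨hp, hp'⟩
    exact (exists_hcChart ha hv hd hp).resolve_right hp'
  · intro p hp
    rcases exists_hcChart ha hv hd hp with h | h
    · rw [p₁, eq_pt_iff] at h
      obtain ⟨s, hs, h⟩ := h
      generalize d / v = c at *
      obtain ⟨w, hw⟩ := IsAlgClosed.exists_pow_nat_eq (1 - c ^ 2) (n := 2) two_pos
      -- At `u = 0` the chart with sign `-1` is `-c` times the coordinates of `p₁`, whatever `w` is.
      refine ⟨-1, (0, w), ?_, -c / s, div_ne_zero (neg_ne_zero.2 hc) hs, ?_⟩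
      · rw [mem_doubleCover_coverPoly]
        linear_combination hw
      · rw [h]
        ext i
        fin_cases i <;> simp [hcChart] <;> field_simp
    · exact ⟨1, h⟩
  · rintro s ⟨u, w⟩ he hb
    have hu : u ≠ 0 := by simpa using hb
    generalize d / v = c at *
    rcases Int.units_eq_one_or s with rfl | rfl
    · exact ⟨_, he, 1, one_ne_zero, by simp⟩
    · refine ⟨_, inv_mem_doubleCover_coverPoly hu he, u ^ 4, pow_ne_zero 4 hu, ?_⟩
      ext i
      fin_cases i <;> simp [hcChart] <;> field_simp <;> ring

theorem infinite_HCF_inter {a : ℝ} (ha : 0 < a) {v d : ℂ} (hv : v ≠ 0) (hd : d ≠ 0) :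
    (HCF a ![0, v] ![0, v] d ∩
      {q | eval q.rep (X 2 : MvPolynomial (Fin 5) ℂ) ≠ 0}).Infinite := by
  have ha' : (a : ℂ) ≠ 0 := by exact_mod_cast ha.ne'
  have hc : d / v ≠ 0 := div_ne_zero hd hv
  -- This function recovers the parameter `u` from a point of the chart.
  refine Set.Infinite.of_image (fun q => ((a : ℂ) * q.rep 0 - q.rep 1 - q.rep 3) / q.rep 2) ?_
  refine (Polynomial.finite_setOfPred_isRoot (mul_ne_zero Polynomial.X_ne_zero
    (slopePoly_ne_zero hc))).infinite_compl.mono fun u hu => ?_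
  simp only [Set.mem_compl_iff, Set.mem_ofPred_eq, Polynomial.IsRoot.def, Polynomial.eval_mul,
    Polynomial.eval_X, eval_slopePoly] at hu
  have hu0 := left_ne_zero_of_mul hu
  have hM := right_ne_zero_of_mul hu
  obtain ⟨w, hw⟩ := IsAlgClosed.exists_pow_nat_eq
    ((1 + u ^ 2) ^ 2 - (d / v * u ^ 2 + 2 * u + d / v) ^ 2) (n := 2) two_pos
  have h2 : hcChart a (d / v) 1 (u, w) 2 ≠ 0 := by
    simp [hcChart, ha', hu0, hM]
  have hx : hcChart a (d / v) 1 (u, w) ≠ 0 := fun h => h2 (congrFun h 2)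
  obtain ⟨r, hr, hr'⟩ := rep_pt _ hx
  refine ⟨pt _ hx, ⟨?_, ?_⟩, ?_⟩
  · rw [pt_mem_HCF hv]
    simp [hcChart]
    generalize d / v = c at *
    refine ⟨by ring, ?_, by ring⟩
    linear_combination 16 * a ^ 2 * u ^ 2 * hw
  · simp only [Set.mem_ofPred_eq, eval_X, hr', Pi.smul_apply]
    exact smul_ne_zero hr h2
  · simp only [hr', Pi.smul_apply, smul_eq_mul]
    rw [div_eq_iff (mul_ne_zero hr h2)]
    simp [hcChart]
    ring

/-! ### The birational equivalence -/

/-- In the `[z, x]`-coordinates: `[z₁ + z₃, z₀ - z₂, x]`. -/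
def hcToQuartic (a : ℝ) : RatMap 4 2 where
  degree := 1
  poly := ![X 4 - (C (a : ℂ) * X 0 + X 1), X 3 - (C (a : ℂ) * X 0 - X 1), -X 2]
  homogeneous := by
    intro i
    fin_cases i
    · exact (isHomogeneous_X _ _).sub ((isHomogeneous_C_mul_X _ _).add (isHomogeneous_X _ _))
    · exact (isHomogeneous_X _ _).sub ((isHomogeneous_C_mul_X _ _).sub (isHomogeneous_X _ _))
    · exact (isHomogeneous_X _ _).neg

/-- In the `[z, x]`-coordinates:
`[u₀ (u₂² + u₁²), u₁ (u₂² + u₀²), u₀ (u₂² - u₁²), u₁ (u₀² - u₂²), 2 u₀ u₁ u₂]`. -/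
def quarticToHC (a : ℝ) : RatMap 2 4 where
  degree := 3
  poly := ![X 0 * (X 2 ^ 2 - X 1 ^ 2) - X 1 * (X 0 ^ 2 - X 2 ^ 2),
    C (-a : ℂ) * (X 0 * (X 2 ^ 2 - X 1 ^ 2) + X 1 * (X 0 ^ 2 - X 2 ^ 2)),
    C (-4 * a : ℂ) * (X 0 * (X 1 * X 2)),
    C (2 * a : ℂ) * (X 0 * (X 2 ^ 2 + X 1 ^ 2)),
    C (2 * a : ℂ) * (X 1 * (X 2 ^ 2 + X 0 ^ 2))]
  homogeneous := by
    have hX := fun i : Fin 3 => isHomogeneous_X ℂ i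
    have hsub : ∀ i j k : Fin 3,
        (X i * (X j ^ 2 - X k ^ 2) : MvPolynomial (Fin 3) ℂ).IsHomogeneous 3 :=
      fun i j k => (hX i).mul (((hX j).pow 2).sub ((hX k).pow 2))
    have hadd : ∀ i j k : Fin 3,
        (X i * (X j ^ 2 + X k ^ 2) : MvPolynomial (Fin 3) ℂ).IsHomogeneous 3 :=
      fun i j k => (hX i).mul (((hX j).pow 2).add ((hX k).pow 2))
    intro i
    fin_cases i
    · exact (hsub _ _ _).sub (hsub _ _ _)
    · exact ((hsub _ _ _).add (hsub _ _ _)).C_mul _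
    · exact ((hX 0).mul ((hX 1).mul (hX 2))).C_mul _
    · exact (hadd _ _ _).C_mul _
    · exact (hadd _ _ _).C_mul _

/-- Both composites multiply coordinates by `4 a u₀ u₁`, which is nonzero on the chosen open sets:
on the Ho-Chen curve, `y₂ ≠ 0` forces `u₀, u₁ ≠ 0` by the two conic equations. -/
theorem birational_HCF_planeQuartic {a : ℝ} (ha : 0 < a) {v d : ℂ} (hv : v ≠ 0) (hd : d ≠ 0) :
    Birational (HCF a ![0, v] ![0, v] d) (planeQuartic ![0, v] ![0, v] d) := by
  have ha' : (a : ℂ) ≠ 0 := by exact_mod_cast ha.ne'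
  refine ⟨hcToQuartic a, quarticToHC a, {p | eval p.rep (X 2 : MvPolynomial (Fin 5) ℂ) ≠ 0},
    {q | eval q.rep (X 0 * X 1 * X 2 : MvPolynomial (Fin 3) ℂ) ≠ 0},
    isOpen_rep_ne_zero (isHomogeneous_X _ _),
    isOpen_rep_ne_zero (((isHomogeneous_X _ _).mul (isHomogeneous_X _ _)).mul (isHomogeneous_X _ _)),
    (vanishesOfInfinite_HCF ha hv hd).subset_closure (infinite_HCF_inter ha hv hd),
    (vanishesOfInfinite_planeQuartic hv hd).subset_closure (infinite_planeQuartic_inter hv hd),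
    ?_, ?_⟩
  · rintro p ⟨hp, hy⟩
    rw [mem_HCF hv] at hp
    obtain ⟨h1, h2, h3⟩ := hp
    simp only [Set.mem_ofPred_eq, eval_X] at hy
    have hu0 : p.rep 4 - (a * p.rep 0 + p.rep 1) ≠ 0 := by
      intro h
      apply pow_ne_zero 2 hy
      linear_combination h2 + (p.rep 4 + (a * p.rep 0 + p.rep 1)) * h
    have hu1 : p.rep 3 - (a * p.rep 0 - p.rep 1) ≠ 0 := by
      intro h
      apply pow_ne_zero 2 hy
      linear_combination h1 + (p.rep 3 + (a * p.rep 0 - p.rep 1)) * h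
    have hx : (![p.rep 4 - (a * p.rep 0 + p.rep 1), p.rep 3 - (a * p.rep 0 - p.rep 1), -p.rep 2] :
        Fin 3 → ℂ) ≠ 0 := fun h => hu0 (congrFun h 0)
    obtain ⟨r, hr, hr'⟩ := rep_pt _ hx
    refine ⟨pt _ hx, ⟨?_, ?_⟩, ?_, ?_⟩
    · rw [pt_mem_planeQuartic hv]
      generalize d / v = c at *
      simp only [Matrix.cons_val_zero, Matrix.cons_val_one, Matrix.cons_val]
      generalize p.rep = x at *
      have e1 : (x 3 - (a * x 0 - x 1)) ^ 2 + (-x 2) ^ 2 = 2 * x 3 * (x 3 - (a * x 0 - x 1)) := by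
        linear_combination h1
      have e0 : (x 4 - (a * x 0 + x 1)) ^ 2 + (-x 2) ^ 2 = 2 * x 4 * (x 4 - (a * x 0 + x 1)) := by
        linear_combination h2
      rw [e1, e0]
      linear_combination 4 * (x 3 - (a * x 0 - x 1)) * (x 4 - (a * x 0 + x 1)) * h3
    · simp [hr', hr, hu0, hu1, hy]
    · refine RatMap.maps_of_eval_eq _ (inv_ne_zero hr) fun i => ?_
      rw [hr', Pi.smul_apply, smul_eq_mul, inv_mul_cancel_left₀ hr]
      fin_cases i <;> simp [hcToQuartic]
    · refine RatMap.maps_pt_of_eval_eq _ (mul_ne_zero (mul_ne_zero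
        (mul_ne_zero (by norm_num : (4 : ℂ) ≠ 0) ha') hu0) hu1) fun i => ?_
      generalize p.rep = x at *
      fin_cases i <;> simp [quarticToHC]
      · linear_combination (x 4 - (a * x 0 + x 1)) * h1 + (x 3 - (a * x 0 - x 1)) * h2
      · linear_combination -a * (x 4 - (a * x 0 + x 1)) * h1 + a * (x 3 - (a * x 0 - x 1)) * h2
      · ring
      · linear_combination 2 * a * (x 4 - (a * x 0 + x 1)) * h1
      · linear_combination 2 * a * (x 3 - (a * x 0 - x 1)) * h2
  · rintro q ⟨hq, hu⟩
    rw [mem_planeQuartic hv] at hq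
    simp only [Set.mem_ofPred_eq, map_mul, eval_X, ne_eq, mul_eq_zero, not_or] at hu
    obtain ⟨⟨hu0, hu1⟩, hu2⟩ := hu
    set y : Fin 5 → ℂ := fun i => eval q.rep ((quarticToHC a).poly i) with hydef
    have hy2 : y 2 ≠ 0 := by simp [hydef, quarticToHC, ha', hu0, hu1, hu2]
    have hy : y ≠ 0 := fun h => hy2 (congrFun h 2)
    obtain ⟨r, hr, hr'⟩ := rep_pt _ hy
    refine ⟨pt y hy, ⟨?_, ?_⟩, ⟨hy, rfl⟩, ?_⟩
    · rw [pt_mem_HCF hv]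
      simp [hydef, quarticToHC]
      generalize d / v = c at *
      generalize q.rep = u at *
      refine ⟨by ring, by ring, ?_⟩
      linear_combination 4 * a ^ 2 * u 0 * u 1 * hq
    · simp only [Set.mem_ofPred_eq, eval_X, hr', Pi.smul_apply]
      exact smul_ne_zero hr hy2
    · refine RatMap.maps_pt_of_eval_eq _ (mul_ne_zero (mul_ne_zero
        (mul_ne_zero (by norm_num : (4 : ℂ) ≠ 0) ha') hu0) hu1) fun i => ?_
      fin_cases i <;> simp [hcToQuartic, hydef, quarticToHC] <;> ring

/-! ### Singular points -/

theorem rank_lt_iff_exists_vecMul {K ι κ : Type*} [Field K] [Fintype ι] [Fintype κ]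
    (M : Matrix ι κ K) :
    M.rank < Fintype.card ι ↔ ∃ g : ι → K, g ≠ 0 ∧ ∀ j, ∑ i, g i * M i j = 0 := by
  have h1 : M.rank < Fintype.card ι ↔ ¬ LinearIndependent K M.row := by
    rw [linearIndependent_iff_card_eq_finrank_span, Set.finrank, ← M.rank_eq_finrank_span_row]
    have := M.rank_le_card_height
    omega
  rw [h1, Fintype.not_linearIndependent_iff]
  refine exists_congr fun g => ?_
  rw [and_comm, Function.ne_iff, funext_iff]
  simp [Finset.sum_apply, Matrix.row]

/-- Rank less than three means a nonzero relation `g` among the gradients. The `t` and `y₁` columns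
give the sum and difference of the first two conditions, which separate because `a ≠ 0`. -/
theorem mem_singularPoints {a : ℝ} (ha : 0 < a) {v d : ℂ} (p : CP 4) :
    p ∈ singularPoints (hcEquations a ![0, v] ![0, v] d) ↔
      p ∈ HCF a ![0, v] ![0, v] d ∧ ∃ g : Fin 3 → ℂ, g ≠ 0 ∧
        g 0 * (a * p.rep 0 - p.rep 1) = 0 ∧ g 1 * (a * p.rep 0 + p.rep 1) = 0 ∧
        2 * p.rep 2 * (g 0 + g 1) + g 2 * v * (p.rep 4 - p.rep 3) = 0 ∧
        -2 * p.rep 3 * g 0 - g 2 * (v * p.rep 2 + d * p.rep 4) = 0 ∧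
        -2 * p.rep 4 * g 1 + g 2 * (v * p.rep 2 - d * p.rep 3) = 0 := by
  have ha' : (a : ℂ) ≠ 0 := by exact_mod_cast ha.ne'
  refine and_congr Iff.rfl ?_
  rw [rank_lt_iff_exists_vecMul]
  refine exists_congr fun g => and_congr Iff.rfl ?_
  simp [Fin.forall_fin_succ, Fin.sum_univ_succ, jacobian, hcEquations, Q₁, Q₂, fdoaPoly, L₁, L₂,
    pderiv_X, -mul_eq_zero]
  generalize p.rep = x
  constructor
  · rintro ⟨e0, e1, e2, e3, e4⟩
    have e0' : g 0 * (a * x 0 - x 1) + g 1 * (a * x 0 + x 1) = 0 := by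
      apply mul_left_cancel₀ (mul_ne_zero two_ne_zero ha')
      linear_combination e0
    refine ⟨?_, ?_, ?_, ?_, ?_⟩
    · linear_combination e0' / 2 - e1 / 4
    · linear_combination e0' / 2 + e1 / 4
    · linear_combination e2
    · linear_combination e3
    · linear_combination e4
  · rintro ⟨e0, e1, e2, e3, e4⟩
    refine ⟨?_, ?_, ?_, ?_, ?_⟩
    · linear_combination 2 * a * e0 + 2 * a * e1
    · linear_combination -2 * e0 + 2 * e1
    · linear_combination e2
    · linear_combination e3
    · linear_combination e4

/-- If `y₂ = 0`, then `r₁ r₂ = 0` and the conics leave only the four nodes. If `y₂ ≠ 0`, a relation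
`g` forces `a t - y₁ = a t + y₁ = 0`; then `r₂ = -r₁` and `y₂ = ±r₁`, which the FDOA equation allows
only for `d = ±2 v`. -/
theorem mem_singularPoints_iff {a : ℝ} (ha : 0 < a) {v d : ℂ} (hv : v ≠ 0) (hd : d ≠ 0) (p : CP 4) :
    p ∈ singularPoints (hcEquations a ![0, v] ![0, v] d) ↔
      p = p₁ a ∨ p = p₂ a ∨ p = p₃ a ∨ p = p₄ a ∨ (d = 2 * v ∧ p = qTilde) ∨
        (d = -2 * v ∧ p = q) := by
  have ha' : (a : ℂ) ≠ 0 := by exact_mod_cast ha.ne'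
  have hrep := p.rep_nonzero
  simp only [mem_singularPoints ha, mem_HCF hv, p₁, p₂, p₃, p₄, qTilde, q, eq_pt_iff]
  generalize p.rep = x at *
  constructor
  · rintro ⟨⟨h1, h2, h3⟩, g, hg, e0, e1, e2, e3, e4⟩
    have h3' : v * x 2 * (x 4 - x 3) = d * x 3 * x 4 := by
      field_simp at h3
      linear_combination h3
    have hg' : g 0 = 0 → g 1 = 0 → g 2 = 0 → False := by
      intro g0 g1 g2
      apply hg
      ext i
      fin_cases i <;> assumption
    by_cases hy : x 2 = 0
    · simp only [hy, mul_zero, zero_mul, ne_eq, OfNat.ofNat_ne_zero, not_false_eq_true, zero_pow,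
        add_zero] at h1 h2 h3'
      rcases mul_eq_zero.1 h3'.symm with h | hr2
      · have hr1 := (mul_eq_zero.1 h).resolve_left hd
        have hx1 : x 1 = a * x 0 := by
          rw [hr1] at h1
          linear_combination -(pow_eq_zero_iff two_ne_zero).1 (h1.trans (zero_pow two_ne_zero))
        rw [hx1] at h2
        have h0 : x 0 ≠ 0 := by
          intro h0
          have hr2 : x 4 = 0 := by simpa [h0] using h2.symm
          apply hrep
          ext i
          fin_cases i <;> simp [hy, hr1, hr2, hx1, h0]
        have : (x 4 - 2 * a * x 0) * (x 4 + 2 * a * x 0) = 0 := by linear_combination -h2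
        rcases mul_eq_zero.1 this with h | h
        · right; right; left
          refine ⟨x 0, h0, ?_⟩
          ext i
          fin_cases i <;> simp [hy, hr1, hx1]
          · ring
          · linear_combination h
        · right; right; right; left
          refine ⟨x 0, h0, ?_⟩
          ext i
          fin_cases i <;> simp [hy, hr1, hx1]
          · ring
          · linear_combination h
      · have hx1 : x 1 = -a * x 0 := by
          rw [hr2] at h2
          linear_combination (pow_eq_zero_iff two_ne_zero).1 (h2.trans (zero_pow two_ne_zero))
        rw [hx1] at h1
        have h0 : x 0 ≠ 0 := by
          intro h0
          have hr1 : x 3 = 0 := by simpa [h0] using h1.symm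
          apply hrep
          ext i
          fin_cases i <;> simp [hy, hr1, hr2, hx1, h0]
        have : (x 3 - 2 * a * x 0) * (x 3 + 2 * a * x 0) = 0 := by linear_combination -h1
        rcases mul_eq_zero.1 this with h | h
        · right; left
          refine ⟨x 0, h0, ?_⟩
          ext i
          fin_cases i <;> simp [hy, hr2, hx1]
          · ring
          · linear_combination h
        · left
          refine ⟨x 0, h0, ?_⟩
          ext i
          fin_cases i <;> simp [hy, hr2, hx1]
          · ring
          · linear_combination h
    · right; right; right; right
      by_cases hA : a * x 0 - x 1 = 0
      · have hr1 : x 3 ≠ 0 := by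
          intro hr1
          rw [hA, hr1] at h1
          simp [hy] at h1
        by_cases hB : a * x 0 + x 1 = 0
        · have h0 : x 0 = 0 := by
            apply mul_left_cancel₀ (mul_ne_zero two_ne_zero ha')
            linear_combination hA + hB
          have hx1 : x 1 = 0 := by linear_combination (hB - hA) / 2
          rw [hA] at h1
          rw [hB] at h2
          have h12 : (x 4 - x 3) * (x 4 + x 3) = 0 := by linear_combination h1 - h2
          -- The alternative `r₂ = r₁` would turn the FDOA equation into `d r₁² = 0`.
          have hr2 : x 4 = -x 3 := by
            rcases mul_eq_zero.1 h12 with h | h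
            · have hr2 : x 4 = x 3 := by linear_combination h
              rw [hr2] at h3'
              simp [hd, hr1] at h3'
            · linear_combination h
          have hdv : 2 * v * x 2 = d * x 3 := by
            apply mul_left_cancel₀ hr1
            rw [hr2] at h3'
            linear_combination -h3'
          have hy1 : (x 2 - x 3) * (x 2 + x 3) = 0 := by linear_combination h1
          rcases mul_eq_zero.1 hy1 with h | h
          · left
            refine ⟨?_, x 3, hr1, ?_⟩
            · apply mul_right_cancel₀ hr1
              linear_combination 2 * v * h - hdv
            · ext i
              fin_cases i <;> simp [h0, hx1, hr2]
              linear_combination h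
          · right
            refine ⟨?_, x 3, hr1, ?_⟩
            · apply mul_right_cancel₀ hr1
              linear_combination 2 * v * h - hdv
            · ext i
              fin_cases i <;> simp [h0, hx1, hr2]
              linear_combination h
        · exfalso
          have g1 := (mul_eq_zero.1 e1).resolve_right hB
          have g2 : g 2 ≠ 0 := by
            intro g2
            refine hg' ?_ g1 g2
            simpa [g2, hr1] using e3
          -- Substituting `v y₂ = d r₁` into the FDOA equation leaves `d r₁² = 0`, a contradiction;
          -- the mirror case below ends with `d r₂² = 0`.
          have h4 : v * x 2 - d * x 3 = 0 := by
            rw [g1] at e4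
            simpa [g2] using e4
          have : d * x 3 ^ 2 = 0 := by linear_combination (x 4 - x 3) * h4 - h3'
          simp [hd, hr1] at this
      · exfalso
        have g0 := (mul_eq_zero.1 e0).resolve_right hA
        by_cases hB : a * x 0 + x 1 = 0
        · have hr2 : x 4 ≠ 0 := by
            intro hr2
            rw [hB, hr2] at h2
            simp [hy] at h2
          have g2 : g 2 ≠ 0 := by
            intro g2
            refine hg' g0 ?_ g2
            simpa [g2, hr2] using e4
          have h4 : v * x 2 + d * x 4 = 0 := by
            rw [g0] at e3
            simpa [g2] using e3
          have : d * x 4 ^ 2 = 0 := by linear_combination (x 4 - x 3) * h4 - h3'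
          simp [hd, hr2] at this
        · have g1 := (mul_eq_zero.1 e1).resolve_right hB
          have g2 : g 2 ≠ 0 := fun g2 => hg' g0 g1 g2
          rw [g0, g1] at e2
          rw [g0] at e3
          rw [g1] at e4
          have h5 : x 4 - x 3 = 0 := by simpa [g2, hv] using e2
          have h6 : v * x 2 + d * x 4 = 0 := by simpa [g2] using e3
          have h7 : v * x 2 - d * x 3 = 0 := by simpa [g2] using e4
          have : 2 * v * x 2 = 0 := by linear_combination h6 + h7 - d * h5
          simp [hv, hy] at this
  · have ne1 : (![0, 1, 0] : Fin 3 → ℂ) ≠ 0 := fun h => by simpa using congrFun h 1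
    have ne0 : (![1, 0, 0] : Fin 3 → ℂ) ≠ 0 := fun h => by simpa using congrFun h 0
    have ne2 : ∀ s : ℂ, (![s, s, 2] : Fin 3 → ℂ) ≠ 0 := fun s h => by simpa using congrFun h 2
    rintro (⟨r, -, rfl⟩ | ⟨r, -, rfl⟩ | ⟨r, -, rfl⟩ | ⟨r, -, rfl⟩ | ⟨rfl, r, -, rfl⟩ | ⟨rfl, r, -, rfl⟩)
    -- `p₁` and `p₂` lie on the vertex line of the quadric cone `Q₂ = 0`, so the gradient of `Q₂`
    -- vanishes there; `p₃` and `p₄` play the same role for `Q₁`.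
    · refine ⟨⟨?_, ?_, ?_⟩, ![0, 1, 0], ne1, ?_⟩ <;> simp <;> ring
    · refine ⟨⟨?_, ?_, ?_⟩, ![0, 1, 0], ne1, ?_⟩ <;> simp <;> ring
    · refine ⟨⟨?_, ?_, ?_⟩, ![1, 0, 0], ne0, ?_⟩ <;> simp <;> ring
    · refine ⟨⟨?_, ?_, ?_⟩, ![1, 0, 0], ne0, ?_⟩ <;> simp <;> ring
    -- Here no single gradient vanishes; the relation involves all three.
    · refine ⟨⟨?_, ?_, ?_⟩, ![v, v, 2], ne2 v, ?_, ?_, ?_, ?_, ?_⟩ <;> simp <;> field_simp <;> ring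
    · refine ⟨⟨?_, ?_, ?_⟩, ![-v, -v, 2], ne2 (-v), ?_, ?_, ?_, ?_, ?_⟩ <;> simp <;> field_simp <;> ring

theorem ncard_nodes {a : ℝ} (ha : 0 < a) : ({p₁ a, p₂ a, p₃ a, p₄ a} : Set (CP 4)).ncard = 4 := by
  have h2 : (2 : ℂ) * a ≠ -2 * a := by
    intro h
    have : (4 : ℂ) * a = 0 := by linear_combination h
    simp [ha.ne'] at this
  have h1 : (a : ℂ) ≠ -a := by
    intro h
    have : (2 : ℂ) * a = 0 := by linear_combination h
    simp [ha.ne'] at this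
  have h12 : p₁ a ≠ p₂ a := pt_ne_pt_of_minor 0 3 (by simpa using h2)
  have h34 : p₃ a ≠ p₄ a := pt_ne_pt_of_minor 0 4 (by simpa using h2.symm)
  have h13 : p₁ a ≠ p₃ a := pt_ne_pt_of_minor 0 1 (by simpa using h1)
  have h14 : p₁ a ≠ p₄ a := pt_ne_pt_of_minor 0 1 (by simpa using h1)
  have h23 : p₂ a ≠ p₃ a := pt_ne_pt_of_minor 0 1 (by simpa using h1)
  have h24 : p₂ a ≠ p₄ a := pt_ne_pt_of_minor 0 1 (by simpa using h1)
  rw [Set.ncard_insert_of_notMem (by simp [h12, h13, h14]),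
    Set.ncard_insert_of_notMem (by simp [h23, h24]), Set.ncard_pair h34]

theorem ncard_nodes_insert {a : ℝ} (ha : 0 < a) {p : CP 4}
    (hp : p ∉ ({p₁ a, p₂ a, p₃ a, p₄ a} : Set (CP 4))) :
    ({p₁ a, p₂ a, p₃ a, p₄ a, p} : Set (CP 4)).ncard = 5 := by
  have : ({p₁ a, p₂ a, p₃ a, p₄ a, p} : Set (CP 4)) = insert p {p₁ a, p₂ a, p₃ a, p₄ a} := by
    ext x
    simp only [Set.mem_insert_iff, Set.mem_singleton_iff]
    tauto
  rw [this, Set.ncard_insert_of_notMem hp (by simp), ncard_nodes ha]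

theorem q_notMem_nodes (a : ℝ) : q ∉ ({p₁ a, p₂ a, p₃ a, p₄ a} : Set (CP 4)) := by
  simp only [Set.mem_insert_iff, Set.mem_singleton_iff, not_or]
  refine ⟨?_, ?_, ?_, ?_⟩ <;> exact pt_ne_pt_of_minor 3 0 (by simp)

theorem qTilde_notMem_nodes (a : ℝ) : qTilde ∉ ({p₁ a, p₂ a, p₃ a, p₄ a} : Set (CP 4)) := by
  simp only [Set.mem_insert_iff, Set.mem_singleton_iff, not_or]
  refine ⟨?_, ?_, ?_, ?_⟩ <;> exact pt_ne_pt_of_minor 3 0 (by simp)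

end HoChen

end

theorem mainTheorem6 (a : ℝ) (ha : 0 < a) (v d : ℂ) (hd : d ≠ 0) (hv : v ≠ 0) :
    HoChen.IsIrreducibleCurve (HoChen.HCF a ![0, v] ![0, v] d) ∧
    HoChen.IsIrreducibleCurve (HoChen.planeQuartic ![0, v] ![0, v] d) ∧
    HoChen.Birational (HoChen.HCF a ![0, v] ![0, v] d)
      (HoChen.planeQuartic ![0, v] ![0, v] d) ∧
    (d ^ 2 ≠ 4 * v ^ 2 →
      HoChen.singularPoints (HoChen.hcEquations a ![0, v] ![0, v] d) =
          {HoChen.p₁ a, HoChen.p₂ a, HoChen.p₃ a, HoChen.p₄ a} ∧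
      (HoChen.singularPoints (HoChen.hcEquations a ![0, v] ![0, v] d)).ncard = 4) ∧
    (d = 2 * v →
      HoChen.singularPoints (HoChen.hcEquations a ![0, v] ![0, v] d) =
          {HoChen.p₁ a, HoChen.p₂ a, HoChen.p₃ a, HoChen.p₄ a, HoChen.qTilde} ∧
      (HoChen.singularPoints (HoChen.hcEquations a ![0, v] ![0, v] d)).ncard = 5) ∧
    (d = -2 * v →
      HoChen.singularPoints (HoChen.hcEquations a ![0, v] ![0, v] d) =
          {HoChen.p₁ a, HoChen.p₂ a, HoChen.p₃ a, HoChen.p₄ a, HoChen.q} ∧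
      (HoChen.singularPoints (HoChen.hcEquations a ![0, v] ![0, v] d)).ncard = 5) := by
  have hV := HoChen.vanishesOfInfinite_planeQuartic hv hd
  have hH := HoChen.vanishesOfInfinite_HCF ha hv hd
  have hsing := HoChen.mem_singularPoints_iff ha hv hd
  refine ⟨hH.isIrreducibleCurve (HoChen.isClosed_zeroLocus
      (HoChen.isHomogeneous_hcEquations _ _ _ _))
      ((HoChen.infinite_HCF_inter ha hv hd).mono Set.inter_subset_left),
    hV.isIrreducibleCurve (HoChen.isClosed_zeroLocus
      fun _ => ⟨4, HoChen.isHomogeneous_quarticPoly _ _ _⟩)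
      ((HoChen.infinite_planeQuartic_inter hv hd).mono Set.inter_subset_left),
    HoChen.birational_HCF_planeQuartic ha hv hd, ?_, ?_, ?_⟩
  · intro h
    have h1 : d ≠ 2 * v := by
      rintro rfl
      exact h (by ring)
    have h2 : d ≠ -2 * v := by
      rintro rfl
      exact h (by ring)
    have hS : HoChen.singularPoints (HoChen.hcEquations a ![0, v] ![0, v] d) =
        {HoChen.p₁ a, HoChen.p₂ a, HoChen.p₃ a, HoChen.p₄ a} := by
      ext p
      simp [-neg_mul, hsing p, h1, h2]
    exact ⟨hS, hS ▸ HoChen.ncard_nodes ha⟩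
  · intro h
    have h2 : d ≠ -2 * v := by
      intro h'
      have : 4 * v = 0 := by linear_combination h' - h
      simp [hv] at this
    have hS : HoChen.singularPoints (HoChen.hcEquations a ![0, v] ![0, v] d) =
        {HoChen.p₁ a, HoChen.p₂ a, HoChen.p₃ a, HoChen.p₄ a, HoChen.qTilde} := by
      ext p
      simp only [hsing p, h2, false_and, or_false, Set.mem_insert_iff, Set.mem_singleton_iff,
        and_iff_right h]
    exact ⟨hS, hS ▸ HoChen.ncard_nodes_insert ha (HoChen.qTilde_notMem_nodes a)⟩
  · intro h
    have h1 : d ≠ 2 * v := by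
      intro h'
      have : 4 * v = 0 := by linear_combination h - h'
      simp [hv] at this
    have hS : HoChen.singularPoints (HoChen.hcEquations a ![0, v] ![0, v] d) =
        {HoChen.p₁ a, HoChen.p₂ a, HoChen.p₃ a, HoChen.p₄ a, HoChen.q} := by
      ext p
      simp only [hsing p, h1, false_and, false_or, Set.mem_insert_iff, Set.mem_singleton_iff,
        and_iff_right h]
    exact ⟨hS, hS ▸ HoChen.ncard_nodes_insert ha (HoChen.q_notMem_nodes a)⟩
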